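/- All graphs are simple and connected, $d$ denotes the graph distance, and a subgraph is isometrically embedded if its own distance is the restriction of the distance of the ambient graph. A flag simplicial complex $X$ is \emph{systolic} if its $1$-skeleton $G$ is connected and every isometric cycle of $G$ has length $3$. For vertices $u,v$ of $X$ let $I(u,v)=\{x : d(u,x)+d(x,v)=d(u,v)\}$, and for $0\le k\le d(u,v)$ let the level $L_k(u,v)$ be the subgraph of $G$ induced by $\{x\in I(u,v) : d(u,x)=k\}$. For $B,C>0$, a map $f\colon Y\to Z$ of metric spaces is a \emph{$(B,C)$-quasi-isometry} if the $C$-neighbourhood of $f(Y)$ is $Z$ and $B^{-1}d(y,y')-C\le d(f(y),f(y'))\le B\,d(y,y')+C$ for all $y,y'\in Y$. A \emph{segment} is a finite path graph. $X$ is \emph{fit} if there are $B,C>0$ such that for every level $L_k(u,v)$ there is a $(B,C)$-quasi-isometry from it to a segment. The \emph{$n$-tripod} consists of a vertex with three paths of length $n$ attached to it; the \emph{$n$-asteroid} consists of a triangle with one path of length $n$ attached to each of its three vertices. The \emph{triplane} has vertices $v_i$ and $a_i,b_i,c_i$ ($i\in\mathbb Z$), where $\{v_{i-1},a_i,b_i,c_i\}$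 and $\{v_i,a_i,b_i,c_i\}$ span tetrahedra, and along each of the three zigzag geodesics $(\dots,v_{i-1},a_i,v_i,a_{i+1},\dots)$, and likewise with $b$ and with $c$, a half-plane is glued. The half-plane is the part of the triangular lattice in the plane whose vertices have rows at heights indexed by $r\in\mathbb Z$, at horizontal positions $0,1,2,\dots$ if $r$ is even and $\frac12,\frac32,\dots$ if $r$ is odd; $v_i$ is at position $0$ in row $2i$, and $a_i$ (or $b_i$, $c_i$) at position $\frac12$ in row $2i-1$. The \emph{$n$-arrowhead} is the subgraph of the ($1$-skeleton of the) triplane induced by the interval $I(v_0,v_n)$. For $N,M\in\mathbb N$, a graph is \emph{$N$-branchless} if it contains no isometrically embedded $n$-tripod and no isometrically embedded $n$-asteroid with $n>N$; it is \emph{$M$-harmless} if it contains no isometrically embedded $m$-arrowhead with $m>M$, and $X$ is $M$-harmless if its $1$-skeleton is. \textbf{Proposition.} Let $X$ be a systolic complex. The following are equivalent: (1) $X$ is fit; (2) there exists $N\in\mathbb N$ such that all levels of all intervals of $X$ are $N$-branchless; (3) there exists $M\in\mathbb N$ such that $X$ is $M$-harmless. Furthermore, for every $N\in\mathbb N$,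 if all levels of all intervals of $X$ are $N$-branchless, then every level of every interval of $X$ is $(1,2N+2)$-quasi-isometric to a segment. -/

import Mathlib

namespace FitSystolic

/-! ### Graph metrics -/

/-- `f` is an isometric embedding of the graph `P` into the graph `G`: it preserves the graph
distance. For connected `P` such an `f` is injective, it identifies `P` with an induced subgraph
of `G`, and the intrinsic distance of that subgraph is the distance of `G`. -/
def IsIsometricEmbedding {W V : Type*} (P : SimpleGraph W) (G : SimpleGraph V) (f : W → V) :
    Prop :=
  ∀ x y : W, G.dist (f x) (f y) = P.dist x y

/-- The graph `G` contains an isometrically embedded copy of `P`. -/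
def ContainsIsometric {W V : Type*} (G : SimpleGraph V) (P : SimpleGraph W) : Prop :=
  ∃ f : W → V, IsIsometricEmbedding P G f

/-- A connected graph is bridged if all its isometric cycles have length `3`. -/
def IsBridged {V : Type*} (G : SimpleGraph V) : Prop :=
  G.Connected ∧ ∀ n : ℕ, 3 ≤ n → ContainsIsometric G (SimpleGraph.cycleGraph n) → n = 3

/-- The interval `I(u,v)`: all vertices on shortest paths between `u` and `v`. -/
def interval {V : Type*} (G : SimpleGraph V) (u v : V) : Set V :=
  {x | G.dist u x + G.dist x v = G.dist u v}

/-- The vertices of the interval `I(u,v)` at distance `k` from `u`. -/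
def levelSet {V : Type*} (G : SimpleGraph V) (u v : V) (k : ℕ) : Set V :=
  {x | x ∈ interval G u v ∧ G.dist u x = k}

/-- The `k`-level `L_k(u,v)`, as an induced subgraph (with its own graph distance). -/
def level {V : Type*} (G : SimpleGraph V) (u v : V) (k : ℕ) : SimpleGraph (levelSet G u v k) :=
  G.induce (levelSet G u v k)

/-- `f` is a `(B,C)`-quasi-isometry between the vertex sets of two graphs with their graph
distances. -/
def IsQuasiIsometry {V W : Type*} (G : SimpleGraph V) (H : SimpleGraph W) (B C : ℝ)
    (f : V → W) : Prop :=
  (∀ y : W, ∃ x : V, (H.dist y (f x) : ℝ) ≤ C) ∧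
    ∀ x x' : V,
      B⁻¹ * (G.dist x x' : ℝ) - C ≤ (H.dist (f x) (f x') : ℝ) ∧
        (H.dist (f x) (f x') : ℝ) ≤ B * (G.dist x x' : ℝ) + C

/-- `G` is `(B,C)`-quasi-isometric to a segment, that is, to a finite path graph
(`pathGraph (n + 1)` is the path with `n` edges). -/
def IsQuasiSegment {V : Type*} (G : SimpleGraph V) (B C : ℝ) : Prop :=
  ∃ (n : ℕ) (f : V → Fin (n + 1)), IsQuasiIsometry G (SimpleGraph.pathGraph (n + 1)) B C f

/-! ### Tripods, asteroids, arrowheads -/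

/-- The `n`-tripod: a centre `none` with three paths of length `n` attached;
`some (a, i)` is the vertex of the leg `a` at distance `i + 1` from the centre. -/
def tripod (n : ℕ) : SimpleGraph (Option (Fin 3 × Fin n)) :=
  SimpleGraph.fromRel fun x y =>
    match x, y with
    | none, some (_, i) => i.val = 0
    | some (a, i), some (b, j) => a = b ∧ i.val + 1 = j.val
    | _, _ => False

/-- The `n`-asteroid: a triangle with a path of length `n` attached to each of its vertices;
`(a, i)` is the vertex of the leg `a` at distance `i` from the vertex `(a, 0)` of the triangle. -/
def asteroid (n : ℕ) : SimpleGraph (Fin 3 × Fin (n + 1)) :=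
  SimpleGraph.fromRel fun x y =>
    (x.1 = y.1 ∧ x.2.val + 1 = y.2.val) ∨ (x.1 ≠ y.1 ∧ x.2.val = 0 ∧ y.2.val = 0)

/-- A vertex of the triplane. The triplane consists of three half-planes (`wing`) of the
triangular lattice. The vertices of a half-plane lie on horizontal rows, indexed by `row`, and
`off` is twice the horizontal distance from the axis line: in the rows of even index these
are `0, 2, 4, …` and in the rows of odd index `1, 3, 5, …`. The vertices with `off = 0` belong to
all three half-planes, so only one copy of them is kept. -/
@[ext]
structure TriplaneVertex where
  row : ℤ
  off : ℕ
  wing : Fin 3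
  parity : Even (row + off)
  wing_eq : off = 0 → wing = 0

/-- The vertex `v_i` on the axis of the triplane. -/
def axisVertex (i : ℤ) : TriplaneVertex where
  row := 2 * i
  off := 0
  wing := 0
  parity := by simp
  wing_eq := fun _ => rfl

/-- The triplane. Two vertices of a common half-plane are adjacent when they are adjacent in the
triangular lattice: both their rows and their doubled horizontal positions differ by one, or they
are in the same row and the doubled horizontal positions differ by two. The only edges between
different half-planes are those of the triangles `a_i b_i c_i` formed by the three vertices of the
row `2 i - 1` with `off = 1`. Thus `v_i, a_i, b_i, c_i` and `v_{i-1}, a_i, b_i, c_i` span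
tetrahedra, and the half-planes are attached along the zigzag geodesics
`…, v_{i-1}, a_i, v_i, a_{i+1}, …` (and likewise for `b` and `c`). -/
def triplane : SimpleGraph TriplaneVertex where
  Adj x y :=
    ((x.wing = y.wing ∨ x.off = 0 ∨ y.off = 0) ∧
      ((|x.row - y.row| = 1 ∧ |(x.off : ℤ) - y.off| = 1) ∨
        (x.row = y.row ∧ |(x.off : ℤ) - y.off| = 2))) ∨
    (x.wing ≠ y.wing ∧ x.row = y.row ∧ x.off = 1 ∧ y.off = 1)
  symm := ⟨fun x y h => by
    rw [abs_sub_comm y.row, abs_sub_comm (y.off : ℤ)]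
    rcases h with ⟨h1, h2⟩ | ⟨h1, h2, h3, h4⟩
    · refine Or.inl ⟨?_, ?_⟩
      · rcases h1 with h | h | h
        · exact Or.inl h.symm
        · exact Or.inr (Or.inr h)
        · exact Or.inr (Or.inl h)
      · rcases h2 with h | ⟨h, h'⟩
        · exact Or.inl h
        · exact Or.inr ⟨h.symm, h'⟩
    · exact Or.inr ⟨h1.symm, h2.symm, h4, h3⟩⟩
  loopless := ⟨fun x h => by simp at h⟩

/-- The `n`-arrowhead: the interval `I(v_0, v_n)` of the triplane, as an induced subgraph. -/
def arrowhead (n : ℕ) :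
    SimpleGraph (interval triplane (axisVertex 0) (axisVertex (n : ℤ))) :=
  triplane.induce (interval triplane (axisVertex 0) (axisVertex (n : ℤ)))

/-- `G` is `N`-branchless: no isometrically embedded `n`-tripods or `n`-asteroids with `n > N`. -/
def IsBranchless {V : Type*} (G : SimpleGraph V) (N : ℕ) : Prop :=
  ∀ n : ℕ, N < n → ¬ ContainsIsometric G (tripod n) ∧ ¬ ContainsIsometric G (asteroid n)

/-- `G` is `M`-harmless: no isometrically embedded `m`-arrowheads with `m > M`. -/
def IsHarmless {V : Type*} (G : SimpleGraph V) (M : ℕ) : Prop :=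
  ∀ m : ℕ, M < m → ¬ ContainsIsometric G (arrowhead m)

/-! ### Systolic complexes -/

/-- The `1`-skeleton of a simplicial complex, as a graph. -/
def skeleton {V : Type*} (X : AbstractSimplicialComplex V) : SimpleGraph V where
  Adj u v := u ≠ v ∧ ∃ s ∈ X.faces, u ∈ s ∧ v ∈ s
  symm := ⟨fun _ _ ⟨h, s, hs, hu, hv⟩ => ⟨h.symm, s, hs, hv, hu⟩⟩
  loopless := ⟨fun _ h => h.1 rfl⟩

/-- A simplicial complex is flag if every nonempty finite clique of its `1`-skeleton spans a
simplex. -/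
def IsFlag {V : Type*} (X : AbstractSimplicialComplex V) : Prop :=
  ∀ s : Finset V, s.Nonempty → (skeleton X).IsClique (s : Set V) → s ∈ X.faces

/-- A flag simplicial complex is systolic if its `1`-skeleton is bridged. -/
def IsSystolic {V : Type*} (X : AbstractSimplicialComplex V) : Prop :=
  IsFlag X ∧ IsBridged (skeleton X)

/-- All levels of all intervals of `X` are `(B,C)`-quasi-isometric to segments. -/
def LevelsQuasiSegments {V : Type*} (X : AbstractSimplicialComplex V) (B C : ℝ) : Prop :=
  ∀ (u v : V) (k : ℕ), k ≤ (skeleton X).dist u v → IsQuasiSegment (level (skeleton X) u v k) B C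

/-- `X` is fit: its levels are uniformly quasi-isometric to segments. -/
def IsFit {V : Type*} (X : AbstractSimplicialComplex V) : Prop :=
  ∃ B C : ℝ, 0 < B ∧ 0 < C ∧ LevelsQuasiSegments X B C

/-- All levels of all intervals of `X` are `N`-branchless. -/
def LevelsBranchless {V : Type*} (X : AbstractSimplicialComplex V) (N : ℕ) : Prop :=
  ∀ (u v : V) (k : ℕ), k ≤ (skeleton X).dist u v → IsBranchless (level (skeleton X) u v k) N

end FitSystolic

/-!
The proof runs through the cycle fit → harmless → branchless → fit, the last step with the explicit
constants. All arguments take place in the `1`-skeleton `G`, a bridged graph.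

*Bridged graphs.* A shortest violation of the triangle condition or of the interval neighbourhood
condition spans an isometric cycle, so both hold in `G` (`IsBridged.conditions`). It follows that
balls are convex (`IsBridged.dist_le_max`), hence levels of intervals are convex and isometrically
embedded (`level_dist`). For two consecutive levels, the neighbours of a vertex in the other level
form a clique, and every clique of at most three vertices has a common neighbour in the other
level. These properties are collected in `IsSandwich`; the geometry of a single level follows from
them.

*Branchless implies fit.* Passing to the lower level and back shows that levels contain no metric
triangles of side two (`IsSandwich.exists_closer`), so three vertices of a level always have a
median vertex or a median triangle (`IsSandwich.exists_median`), that is, they span a tripod or an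
asteroid with legs of possibly different lengths. Moreover geodesics with common ends stay at
distance at most one from each other (`IsSandwich.interval_clique`). Let `x, y` be a diametral pair
of a level and map `z` to `(d(x,z) + d(x,y) - d(y,z)) / 2`. By maximality the leg at `z` of the
median of `x, y, z` is the shortest one, so it has length at most `N`, and comparing two vertices
gives the additive constant `2 * N + 2`. The estimate is off by one only for two median triangles
over parallel edges, which is repaired by `IsSandwich.dist_le_two_of_parallel`.

*Fit implies harmless.* Distances in the triplane are computed in `triplane_dist`. A row of a large
arrowhead contains a large tripod, which lies isometrically in a level of `G`. In a quasi-segment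
its size is bounded: the image of some end is close to the image of a point on the path between the
other two ends (`le_of_tripod_of_isQuasiSegment`).

*Harmless implies branchless.* The lower neighbours of the edges and of the triangle of an asteroid
form a tripod, so it suffices to treat tripods. Taking successively common neighbours of adjacent
vertices in lower and lower, and in higher and higher levels turns a tripod into the rows of an
arrowhead (`exists_isCone`). That it is isometric follows by moving two vertices diagonally to the
middle row, such that they end up as far apart as possible there
(`IsTripodIn.containsIsometric_arrowhead`). The distance is controlled during this process since a
geodesic of `G` between two levels can be chosen to descend first
(`IsBridged.exists_descending_step`).
-/

namespace FitSystolic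

/-! ### Computing graph distances -/

section Distances

variable {V W : Type*}

lemma exists_walk_of_descent (P : SimpleGraph W) (y : W) (F : W → ℕ)
    (hdesc : ∀ x, x ≠ y → ∃ x', P.Adj x x' ∧ F x' + 1 ≤ F x) (x : W) :
    ∃ w : P.Walk x y, w.length ≤ F x := by
  induction h : F x using Nat.strong_induction_on generalizing x with
  | _ k ih =>
    by_cases hxy : x = y
    · subst hxy
      exact ⟨SimpleGraph.Walk.nil, by simp⟩
    · obtain ⟨x', hadj, hF⟩ := hdesc x hxy
      obtain ⟨w, hw⟩ := ih (F x') (by omega) x' rfl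
      exact ⟨SimpleGraph.Walk.cons hadj w, by simp only [SimpleGraph.Walk.length_cons]; omega⟩

lemma le_add_length_of_lipschitz (P : SimpleGraph W) (F : W → ℕ)
    (hlip : ∀ x x', P.Adj x x' → F x ≤ F x' + 1) {x y : W} (w : P.Walk x y) :
    F x ≤ F y + w.length := by
  induction w with
  | nil => simp
  | cons h w ih =>
    have := hlip _ _ h
    simp only [SimpleGraph.Walk.length_cons]
    omega

/-- A function is the distance to `y` as soon as it is `1`-Lipschitz, vanishes at `y`, and can be
decreased by moving to a suitable neighbour. -/
lemma dist_eq_of_descent (P : SimpleGraph W) (y : W) (F : W → ℕ) (h0 : F y = 0)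
    (hlip : ∀ x x', P.Adj x x' → F x ≤ F x' + 1)
    (hdesc : ∀ x, x ≠ y → ∃ x', P.Adj x x' ∧ F x' + 1 ≤ F x) (x : W) :
    P.Reachable x y ∧ P.dist x y = F x := by
  obtain ⟨w, hw⟩ := exists_walk_of_descent P y F hdesc x
  refine ⟨w.reachable, le_antisymm ((SimpleGraph.dist_le w).trans hw) ?_⟩
  obtain ⟨w', hw'⟩ := w.reachable.exists_walk_length_eq_dist
  have := le_add_length_of_lipschitz P F hlip w'
  omega

lemma dist_le_dist_of_adj {P : SimpleGraph W} {G : SimpleGraph V} (hG : G.Connected) {f : W → V}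
    (hf : ∀ x y, P.Adj x y → G.dist (f x) (f y) ≤ 1) {x y : W} (hxy : P.Reachable x y) :
    G.dist (f x) (f y) ≤ P.dist x y := by
  obtain ⟨w, hw⟩ := hxy.exists_walk_length_eq_dist
  have h := le_add_length_of_lipschitz P (fun z => G.dist (f z) (f y)) (fun a b hab => by
    have h1 := hf a b hab
    have h2 := hG.dist_triangle (u := f a) (v := f b) (w := f y)
    omega) w
  simp only [SimpleGraph.dist_self] at h
  omega

lemma pathGraph_dist {n : ℕ} (x y : Fin n) :
    (SimpleGraph.pathGraph n).dist x y = (x.val - y.val) + (y.val - x.val) := by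
  refine (dist_eq_of_descent (SimpleGraph.pathGraph n) y
    (fun x => (x.val - y.val) + (y.val - x.val)) (by simp) ?_ ?_ x).2
  · intro a b hab
    rw [SimpleGraph.pathGraph_adj] at hab
    omega
  · intro a ha
    have ha' : a.val ≠ y.val := fun h => ha (Fin.ext h)
    rcases lt_or_gt_of_ne ha' with h | h
    · refine ⟨⟨a.val + 1, by omega⟩, ?_, ?_⟩
      · rw [SimpleGraph.pathGraph_adj]; left; rfl
      · simp only; omega
    · refine ⟨⟨a.val - 1, by omega⟩, ?_, ?_⟩
      · rw [SimpleGraph.pathGraph_adj]; right; simp only; omega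
      · simp only; omega

lemma cycleGraph_adj_iff {n : ℕ} (x y : Fin n) :
    (SimpleGraph.cycleGraph n).Adj x y ↔
      x ≠ y ∧ (x.val + 1 = y.val ∨ y.val + 1 = x.val ∨ (x.val = 0 ∧ y.val + 1 = n) ∨
        (y.val = 0 ∧ x.val + 1 = n)) := by
  have hx := x.isLt
  have hy := y.isLt
  have key : ∀ a b : ℕ, a < n → b < n → ((n - b + a) % n = 1 ↔
      (a ≠ b ∧ (b + 1 = a ∨ (a = 0 ∧ b + 1 = n)))) := by
    intro a b ha hb
    by_cases hab : b ≤ a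
    · have : n - b + a = (a - b) + n := by omega
      rw [this, Nat.add_mod_right, Nat.mod_eq_of_lt (by omega)]
      omega
    · rw [Nat.mod_eq_of_lt (by omega)]
      omega
  rw [SimpleGraph.cycleGraph_adj', Fin.sub_def, Fin.sub_def]
  simp only [key x.val y.val hx hy, key y.val x.val hy hx, ne_eq, Fin.ext_iff]
  omega

lemma cycleGraph_dist {n : ℕ} (x y : Fin n) :
    (SimpleGraph.cycleGraph n).dist x y =
      min ((x.val - y.val) + (y.val - x.val)) (n - ((x.val - y.val) + (y.val - x.val))) := by
  have hy := y.isLt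
  refine (dist_eq_of_descent (SimpleGraph.cycleGraph n) y
    (fun x => min ((x.val - y.val) + (y.val - x.val)) (n - ((x.val - y.val) + (y.val - x.val))))
    (by simp) ?_ ?_ x).2
  · intro a b hab
    rw [cycleGraph_adj_iff] at hab
    have := a.isLt
    have := b.isLt
    omega
  · intro a ha
    have ha' : a.val ≠ y.val := fun h => ha (Fin.ext h)
    have hal := a.isLt
    -- move up along the cycle if this is the shorter way, and down otherwise
    by_cases hdir : (a.val < y.val ∧ y.val - a.val ≤ n - (y.val - a.val)) ∨
        (y.val < a.val ∧ n - (a.val - y.val) ≤ a.val - y.val)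
    · by_cases hl : a.val + 1 = n
      · refine ⟨⟨0, by omega⟩, ?_, ?_⟩
        · refine (cycleGraph_adj_iff _ _).2 ⟨fun h => ?_, ?_⟩
          · rw [Fin.ext_iff] at h; simp only at h; omega
          · exact Or.inr (Or.inr (Or.inr ⟨rfl, hl⟩))
        · simp only; omega
      · refine ⟨⟨a.val + 1, by omega⟩, ?_, ?_⟩
        · refine (cycleGraph_adj_iff _ _).2 ⟨fun h => ?_, ?_⟩
          · rw [Fin.ext_iff] at h; simp only at h; omega
          · exact Or.inl rfl
        · simp only; omega
    · by_cases hl : a.val = 0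
      · refine ⟨⟨n - 1, by omega⟩, ?_, ?_⟩
        · refine (cycleGraph_adj_iff _ _).2 ⟨fun h => ?_, ?_⟩
          · rw [Fin.ext_iff] at h; simp only at h; omega
          · exact Or.inr (Or.inr (Or.inl ⟨hl, show n - 1 + 1 = n by omega⟩))
        · simp only; omega
      · refine ⟨⟨a.val - 1, by omega⟩, ?_, ?_⟩
        · refine (cycleGraph_adj_iff _ _).2 ⟨fun h => ?_, ?_⟩
          · rw [Fin.ext_iff] at h; simp only at h; omega
          · exact Or.inr (Or.inl (Nat.succ_pred_eq_of_ne_zero hl))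
        · simp only; omega

lemma containsIsometric_cycleGraph {G : SimpleGraph V} {n : ℕ} (f : ℕ → V)
    (h : ∀ i j, i < j → j < n → G.dist (f i) (f j) = min (j - i) (n - (j - i))) :
    ContainsIsometric G (SimpleGraph.cycleGraph n) := by
  refine ⟨fun x => f x.val, fun x y => ?_⟩
  rw [cycleGraph_dist]
  rcases lt_trichotomy x.val y.val with hxy | hxy | hxy
  · rw [h _ _ hxy y.isLt]; omega
  · rw [show x = y from Fin.ext hxy]; simp
  · rw [SimpleGraph.dist_comm, h _ _ hxy x.isLt]; omega

variable {G : SimpleGraph V}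

lemma exists_geodesic (hG : G.Connected) (u v : V) :
    ∃ a : ℕ → V, a 0 = u ∧ a (G.dist u v) = v ∧
      ∀ i j, i ≤ j → j ≤ G.dist u v → G.dist (a i) (a j) = j - i := by
  obtain ⟨w, hw⟩ := hG.exists_walk_length_eq_dist u v
  have hstep : ∀ i j, i ≤ j → j ≤ G.dist u v → G.dist (w.getVert i) (w.getVert j) ≤ j - i := by
    intro i j hij
    induction j, hij using Nat.le_induction with
    | base => intro _; simp
    | succ j hij ih =>
      intro hj
      have h1 := ih (by omega)
      have h2 : G.dist (w.getVert j) (w.getVert (j + 1)) = 1 :=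
        SimpleGraph.dist_eq_one_iff_adj.2 (w.adj_getVert_succ (by omega))
      have h3 := hG.dist_triangle (u := w.getVert i) (v := w.getVert j) (w := w.getVert (j + 1))
      omega
  refine ⟨w.getVert, by simp, by rw [← hw]; simp, fun i j hij hj => le_antisymm (hstep i j hij hj) ?_⟩
  have h1 := hstep 0 i (by omega) (by omega)
  have h2 := hstep j (G.dist u v) hj le_rfl
  have h3 := hG.dist_triangle (u := u) (v := w.getVert i) (w := v)
  have h4 := hG.dist_triangle (u := w.getVert i) (v := w.getVert j) (w := v)
  have h5 : w.getVert (G.dist u v) = v := by rw [← hw]; simp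
  rw [h5] at h2
  simp only [SimpleGraph.Walk.getVert_zero] at h1
  omega

lemma exists_between (hG : G.Connected) {u v : V} {i : ℕ} (hi : i ≤ G.dist u v) :
    ∃ w, G.dist u w = i ∧ G.dist w v = G.dist u v - i := by
  obtain ⟨a, h0, h1, ha⟩ := exists_geodesic hG u v
  refine ⟨a i, ?_, ?_⟩
  · rw [← h0, ha 0 i (by omega) hi]; omega
  · have := ha i _ hi le_rfl
    rwa [h1] at this

end Distances

/-! ### Local convexity of balls in bridged graphs -/

section Bridged

variable {V : Type*} {G : SimpleGraph V}

/-- In a bridged graph every reflexive `4`-cycle has a diagonal. -/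
lemma IsBridged.diagonal_four (hG : IsBridged G) {a b c d : V} (hab : G.dist a b ≤ 1)
    (hbc : G.dist b c ≤ 1) (hcd : G.dist c d ≤ 1) (hda : G.dist d a ≤ 1) :
    G.dist a c ≤ 1 ∨ G.dist b d ≤ 1 := by
  by_contra! h
  obtain ⟨hac, hbd⟩ := h
  have h1 := hG.1.dist_triangle (u := a) (v := b) (w := c)
  have h2 := hG.1.dist_triangle (u := b) (v := c) (w := d)
  have h3 := hG.1.dist_triangle (u := a) (v := d) (w := c)
  rw [SimpleGraph.dist_comm (u := d) (v := c)] at h3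
  rw [SimpleGraph.dist_comm (u := d) (v := a)] at hda
  have := hG.2 4 (by omega) (containsIsometric_cycleGraph
    (fun i => if i = 0 then a else if i = 1 then b else if i = 2 then c else d) (by
      intro i j hij hj
      interval_cases j <;> interval_cases i <;> simp [-SimpleGraph.dist_eq_one_iff_adj] <;> omega))
  omega

/-- In a bridged graph every reflexive `5`-cycle has a diagonal. -/
lemma IsBridged.diagonal_five (hG : IsBridged G) {a b c d e : V} (hab : G.dist a b ≤ 1)
    (hbc : G.dist b c ≤ 1) (hcd : G.dist c d ≤ 1) (hde : G.dist d e ≤ 1) (hea : G.dist e a ≤ 1) :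
    G.dist a c ≤ 1 ∨ G.dist a d ≤ 1 ∨ G.dist b d ≤ 1 ∨ G.dist b e ≤ 1 ∨ G.dist c e ≤ 1 := by
  by_contra! h
  obtain ⟨hac, had, hbd, hbe, hce⟩ := h
  have h1 := hG.1.dist_triangle (u := a) (v := b) (w := c)
  have h2 := hG.1.dist_triangle (u := b) (v := c) (w := d)
  have h3 := hG.1.dist_triangle (u := c) (v := d) (w := e)
  have h4 := hG.1.dist_triangle (u := a) (v := e) (w := d)
  have h5 := hG.1.dist_triangle (u := b) (v := a) (w := e)
  rw [SimpleGraph.dist_comm (u := e) (v := d)] at h4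
  rw [SimpleGraph.dist_comm (u := b) (v := a)] at h5
  rw [SimpleGraph.dist_comm (u := e) (v := a)] at hea
  have := hG.2 5 (by omega) (containsIsometric_cycleGraph
    (fun i => if i = 0 then a else if i = 1 then b else if i = 2 then c else
      if i = 3 then d else e) (by
      intro i j hij hj
      interval_cases j <;> interval_cases i <;> simp [-SimpleGraph.dist_eq_one_iff_adj] <;> omega))
  omega

/-- The triangle condition at distance `k`: the ends of an edge at distance `k ≥ 1` from `u` have a
common neighbour at distance `k - 1` from `u`. -/
def TriangleCondition (G : SimpleGraph V) (k : ℕ) : Prop :=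
  ∀ u x y : V, 1 ≤ k → G.dist u x = k → G.dist u y = k → G.dist x y = 1 →
    ∃ w, G.dist w x = 1 ∧ G.dist w y = 1 ∧ G.dist u w + 1 = k

/-- The interval neighbourhood condition at distance `k`: the neighbours of a vertex at distance
`k` from `u` which lie at distance `k - 1` from `u` form a clique. -/
def IntervalCliqueCondition (G : SimpleGraph V) (k : ℕ) : Prop :=
  ∀ u x y z : V, G.dist u x = k → G.dist x y = 1 → G.dist x z = 1 → G.dist u y + 1 = k →
    G.dist u z + 1 = k → G.dist y z ≤ 1

section Inductive

variable {k : ℕ}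

/-- Two neighbours `y, z` of `x` nearer to `u` are adjacent if a third such neighbour `w` is adjacent to
both: otherwise lower neighbours of the edges `y w` and `w z` complete `y, x, z` to a pentagon without
diagonals. -/
lemma interval_clique_of_three (hG : IsBridged G) (hP : ∀ j < k, TriangleCondition G j)
    (hQ : ∀ j < k, IntervalCliqueCondition G j) {u x y w z : V} (hx : G.dist u x = k)
    (hxy : G.dist x y = 1) (hxz : G.dist x z = 1) (hy : G.dist u y + 1 = k)
    (hw : G.dist u w + 1 = k) (hz : G.dist u z + 1 = k) (hyw : G.dist y w ≤ 1)
    (hwz : G.dist w z ≤ 1) : G.dist y z ≤ 1 := by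
  have tri := fun a b c : V => hG.1.dist_triangle (u := a) (v := b) (w := c)
  have comm := fun a b : V => SimpleGraph.dist_comm (G := G) (u := a) (v := b)
  have t0 := tri y w z
  by_cases h1 : G.dist y w = 0
  · omega
  by_cases h2 : G.dist w z = 0
  · omega
  by_cases hk : k ≤ 1
  · have : y = u := (hG.1.dist_eq_zero_iff.1 (by omega : G.dist u y = 0)).symm
    have : z = u := (hG.1.dist_eq_zero_iff.1 (by omega : G.dist u z = 0)).symm
    simp_all
  obtain ⟨s, hsw, hsz, hs⟩ := hP (k - 1) (by omega) u w z (by omega) (by omega) (by omega) (by omega)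
  obtain ⟨s', hsy', hsw', hs'⟩ :=
    hP (k - 1) (by omega) u y w (by omega) (by omega) (by omega) (by omega)
  have hss := hQ (k - 1) (by omega) u w s s' (by omega) (by rw [comm]; omega) (by rw [comm]; omega)
    (by omega) (by omega)
  have t1 := tri u s x
  have t2 := tri u s' x
  have c1 := comm s x
  have c2 := comm s' x
  have c3 := comm z x
  have c4 := comm y s'
  have c5 := comm s s'
  -- the pentagon `x y s' s z`
  rcases hG.diagonal_five (a := x) (b := y) (c := s') (d := s) (e := z) (by omega) (by omega)
    (by omega) (by omega) (by omega) with h | h | h | h | h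
  · omega
  · omega
  · rcases hG.diagonal_four (a := x) (b := y) (c := s) (d := z) (by omega) h (by omega)
      (by omega) with h | h <;> omega
  · exact h
  · rcases hG.diagonal_four (a := x) (b := y) (c := s') (d := z) (by omega) (by omega) h
      (by omega) with h | h <;> omega

/-- Let `y, z` violate the interval neighbourhood condition at `x`. Seen from a vertex `p ≠ u` between
`u` and `y`, the vertex `z` is further away than `x`. -/
lemma dist_of_not_clique (hG : IsBridged G) (hP : ∀ j < k, TriangleCondition G j)
    (hQ : ∀ j < k, IntervalCliqueCondition G j) {u x y z : V} (hx : G.dist u x = k)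
    (hxy : G.dist x y = 1) (hxz : G.dist x z = 1) (hy : G.dist u y + 1 = k)
    (hz : G.dist u z + 1 = k) (hyz : 2 ≤ G.dist y z) {p : V} {i : ℕ} (hi : 1 ≤ i)
    (hup : G.dist u p = i) (hpy : G.dist p y + i + 1 = k) : G.dist p z + i = k + 1 := by
  have tri := fun a b c : V => hG.1.dist_triangle (u := a) (v := b) (w := c)
  have comm := fun a b : V => SimpleGraph.dist_comm (G := G) (u := a) (v := b)
  have t1 := tri u p x
  have t2 := tri p y x
  have t3 := tri p x z
  have t4 := tri u p z
  have c1 := comm x y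
  by_contra hne
  rcases (by omega : G.dist p z + i + 1 = k ∨ G.dist p z + i = k) with h | h
  · have := hQ (k - i) (by omega) p x y z (by omega) hxy hxz (by omega) (by omega)
    omega
  · obtain ⟨w, hwx, hwz, hw⟩ := hP (k - i) (by omega) p x z (by omega) (by omega) (by omega) hxz
    have hyw := hQ (k - i) (by omega) p x y w (by omega) hxy (by rw [comm]; exact hwx) (by omega)
      (by omega)
    have t5 := tri u p w
    have t6 := tri u w x
    have := interval_clique_of_three hG hP hQ (w := w) hx hxy hxz hy (by omega) hz hyw (by omega)
    omega

/-- Let `y, z` violate the interval neighbourhood condition at `x`. The distance from `p`, between `u`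
and `y`, keeps growing along a geodesic from `z` to `u` until it reaches `k`. The induction is over all
geodesics at once, since the triangle condition may replace the preceding vertex. -/
lemma dist_interval_of_not_clique (hG : IsBridged G) (hP : ∀ j < k, TriangleCondition G j)
    (hQ : ∀ j < k, IntervalCliqueCondition G j) {u x y z : V} (hx : G.dist u x = k)
    (hxy : G.dist x y = 1) (hxz : G.dist x z = 1) (hy : G.dist u y + 1 = k)
    (hz : G.dist u z + 1 = k) (hyz : 2 ≤ G.dist y z) {p : V} {i : ℕ}
    (hup : G.dist u p = i) (hpy : G.dist p y + i + 1 = k) :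
    ∀ t, 1 ≤ t → t ≤ i → ∀ q, G.dist u q + t = k → G.dist q z + 1 = t →
      G.dist p q + i = k + t := by
  have tri := fun a b c : V => hG.1.dist_triangle (u := a) (v := b) (w := c)
  have comm := fun a b : V => SimpleGraph.dist_comm (G := G) (u := a) (v := b)
  have hbase := fun (z : V) hxz hz hyz => dist_of_not_clique hG hP hQ (z := z) hx hxy hxz hy hz hyz
    (p := p) (i := i)
  intro t
  induction t using Nat.strong_induction_on with
  | _ t ih =>
    intro ht hti q huq hqz
    by_cases ht1 : t = 1
    · obtain rfl : q = z := hG.1.dist_eq_zero_iff.1 (by omega)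
      have := hbase q hxz hz hyz (by omega) hup hpy
      omega
    obtain ⟨q', hqq', hq'z⟩ := exists_between hG.1 (u := q) (v := z) (i := 1) (by omega)
    have t1 := tri u q q'
    have t2 := tri u q' z
    have hq' := ih (t - 1) (by omega) (by omega) (by omega) q' (by omega) (by omega)
    obtain ⟨q'', hq'q'', huq'', hpq'', hq''x⟩ : ∃ q'', G.dist q' q'' = 1 ∧
        G.dist u q'' + t = k + 2 ∧ G.dist p q'' + i + 2 = k + t ∧
        ((t = 2 ∧ q'' = x) ∨ G.dist q'' z + 3 = t) := by
      by_cases ht2 : t = 2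
      · obtain rfl : q' = z := hG.1.dist_eq_zero_iff.1 (by omega)
        refine ⟨x, by rw [comm]; exact hxz, by omega, ?_, Or.inl ⟨ht2, rfl⟩⟩
        have t3 := tri u p x
        have t4 := tri p y x
        have c1 := comm x y
        omega
      · obtain ⟨q'', h1, h2⟩ := exists_between hG.1 (u := q') (v := z) (i := 1) (by omega)
        have t3 := tri u q' q''
        have t4 := tri u q'' z
        have := ih (t - 2) (by omega) (by omega) (by omega) q'' (by omega) (by omega)
        exact ⟨q'', h1, by omega, by omega, Or.inr (by omega)⟩
    have t3 := tri u q q''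
    have t4 := tri p q q'
    have t5 := tri p q' q
    have c1 := comm q q'
    by_contra hne
    rcases (by omega : G.dist p q + 1 = G.dist p q' ∨ G.dist p q = G.dist p q') with h | h
    · have := hQ (G.dist p q') (by omega) p q' q q'' rfl (by omega) (by omega) (by omega) (by omega)
      omega
    · obtain ⟨w, hwq, hwq', hw⟩ :=
        hP (G.dist p q') (by omega) p q q' (by omega) (by omega) rfl (by omega)
      have hwq'' := hQ (G.dist p q') (by omega) p q' w q'' rfl (by rw [comm]; omega) (by omega)
        (by omega) (by omega)
      have t6 := tri u q w
      have t7 := tri u w q''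
      have c2 := comm q w
      rcases hq''x with ⟨rfl, rfl⟩ | hq''z
      · obtain rfl : q' = z := hG.1.dist_eq_zero_iff.1 (by omega)
        have c3 := comm q'' w
        have hwx : G.dist q'' w = 1 := by omega
        by_cases hyw : G.dist y w ≤ 1
        · have := interval_clique_of_three hG hP hQ (w := w) hx hxy hxz hy (by omega) hz hyw
            (by omega)
          omega
        · have := hbase w hwx (by omega) (by omega) (by omega) hup hpy
          omega
      · have t8 := tri w q'' z
        have t9 := tri u w z
        have := ih (t - 1) (by omega) (by omega) (by omega) w (by omega) (by omega)
        omega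

/-- A shortest violation of the interval neighbourhood condition spans an isometric cycle of length
`2 * k`. -/
lemma interval_clique_step (hG : IsBridged G) (hP : ∀ j < k, TriangleCondition G j)
    (hQ : ∀ j < k, IntervalCliqueCondition G j) : IntervalCliqueCondition G k := by
  intro u x y z hx hxy hxz hy hz
  have tri := fun a b c : V => hG.1.dist_triangle (u := a) (v := b) (w := c)
  have comm := fun a b : V => SimpleGraph.dist_comm (G := G) (u := a) (v := b)
  by_contra! hyz
  obtain ⟨a, a0, a1, ha⟩ := exists_geodesic hG.1 u y
  obtain ⟨b, b0, b1, hb⟩ := exists_geodesic hG.1 u z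
  have hk : 2 ≤ k := by
    have := tri y u z
    have := comm y u
    omega
  have hau : ∀ i, i < k → G.dist u (a i) = i := fun i hi => by
    have := ha 0 i (by omega) (by omega); rw [a0] at this; omega
  have hay : ∀ i, i < k → G.dist (a i) y + i + 1 = k := fun i hi => by
    have := ha i _ (by omega : i ≤ G.dist u y) le_rfl; rw [a1] at this; omega
  have hbu : ∀ i, i < k → G.dist u (b i) = i := fun i hi => by
    have := hb 0 i (by omega) (by omega); rw [b0] at this; omega
  have hbz : ∀ i, i < k → G.dist (b i) z + i + 1 = k := fun i hi => by
    have := hb i _ (by omega : i ≤ G.dist u z) le_rfl; rw [b1] at this; omega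
  have hax : ∀ i, i < k → G.dist (a i) x + i = k := fun i hi => by
    have t1 := tri (a i) y x
    have t2 := tri u (a i) x
    have := hau i hi
    have := hay i hi
    have := comm y x
    omega
  have hbx : ∀ i, i < k → G.dist (b i) x + i = k := fun i hi => by
    have t1 := tri (b i) z x
    have t2 := tri u (b i) x
    have := hbu i hi
    have := hbz i hi
    have := comm z x
    omega
  have hab : ∀ i j, 1 ≤ i → 1 ≤ j → i < k → j < k →
      G.dist (a i) (b j) = min (i + j) (2 * k - (i + j)) := by
    intro i j hi hj hik hjk
    have t1 := tri (a i) u (b j)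
    have t2 := tri (a i) x (b j)
    have c1 := comm (a i) u
    have c2 := comm x (b j)
    have e1 := hau i hik
    have e2 := hbu j hjk
    have e3 := hax i hik
    have e4 := hbx j hjk
    have key := dist_interval_of_not_clique hG hP hQ hx hxy hxz hy hz hyz (hau i hik) (hay i hik)
    by_cases hij : k ≤ i + j
    · have := key (k - j) (by omega) (by omega) (b j) (by omega) (by have := hbz j hjk; omega)
      omega
    · have h1 := key i (by omega) (by omega) (b (k - i)) (by have := hbu (k - i) (by omega); omega)
        (by have := hbz (k - i) (by omega); omega)
      have h2 := hb j (k - i) (by omega) (by omega)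
      have h3 := tri (a i) (b j) (b (k - i))
      omega
  have := hG.2 (2 * k) (by omega) (containsIsometric_cycleGraph
    (fun m => if m < k then a m else if m = k then x else b (2 * k - m)) (by
      intro i j hij hj
      split_ifs
      · rw [ha i j (by omega) (by omega)]; omega
      · have := hax i (by omega); omega
      · rcases Nat.eq_zero_or_pos i with rfl | hi
        · rw [a0, hbu _ (by omega)]; omega
        · rw [hab i _ hi (by omega) (by omega) (by omega)]; omega
      · omega
      · omega
      · rw [comm]; have := hbx (2 * k - j) (by omega); omega
      · omega
      · omega
      · rw [comm, hb (2 * k - j) (2 * k - i) (by omega) (by omega)]; omega))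
  omega

/-- Let the edge `x y` violate the triangle condition. Seen from a vertex `p ≠ u` between `u` and `x`,
the vertex `y` is further away than `x`. -/
lemma dist_of_no_common (hG : IsBridged G) (hP : ∀ j < k, TriangleCondition G j)
    {u x y : V} (hx : G.dist u x = k) (hy : G.dist u y = k) (hxy : G.dist x y = 1)
    (hno : ∀ w, G.dist w x = 1 → G.dist w y = 1 → G.dist u w + 1 ≠ k)
    {p : V} {i : ℕ} (hi : 1 ≤ i) (hup : G.dist u p = i) (hpx : G.dist p x + i = k) :
    G.dist p y + i = k + 1 := by
  have tri := fun a b c : V => hG.1.dist_triangle (u := a) (v := b) (w := c)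
  have t1 := tri p x y
  have t2 := tri u p y
  by_contra hne
  have h : G.dist p y + i = k := by omega
  by_cases hik : i = k
  · obtain rfl : p = x := hG.1.dist_eq_zero_iff.1 (by omega)
    omega
  obtain ⟨w, hwx, hwy, hw⟩ := hP (k - i) (by omega) p x y (by omega) (by omega) (by omega) hxy
  have t3 := tri u p w
  have t4 := tri u w x
  exact hno w hwx hwy (by omega)

/-- Along a geodesic from `y` to `u`, the vertex `q` is followed on the way to `y` and then to `x`
by two vertices which are closer to `p`. -/
lemma exists_two_of_no_common (hG : IsBridged G) {u x y : V} (hx : G.dist u x = k)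
    (hy : G.dist u y = k) (hxy : G.dist x y = 1)
    (hno : ∀ w, G.dist w x = 1 → G.dist w y = 1 → G.dist u w + 1 ≠ k)
    {p : V} {i : ℕ} (hpx : G.dist p x + i = k) {t : ℕ} (ht1 : 1 ≤ t)
    (ih : ∀ s < t, ∀ q, G.dist u q + s = k → G.dist q y = s → G.dist p q + i = k + 1 + s)
    {q : V} (huq : G.dist u q + t = k) (hqy : G.dist q y = t) :
    ∃ q' q'', G.dist q q' = 1 ∧ G.dist q' q'' = 1 ∧ 2 ≤ G.dist q q'' ∧
      G.dist p q' + i = k + t ∧ G.dist p q'' + 1 = G.dist p q' ∧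
      ((t = 1 ∧ q' = y ∧ q'' = x) ∨ (G.dist u q'' + t = k + 2 ∧ G.dist q'' y + 2 = t)) := by
  have tri := fun a b c : V => hG.1.dist_triangle (u := a) (v := b) (w := c)
  have comm := fun a b : V => SimpleGraph.dist_comm (G := G) (u := a) (v := b)
  obtain ⟨q', hqq', hq'y⟩ := exists_between hG.1 (u := q) (v := y) (i := 1) (by omega)
  have t1 := tri u q q'
  have t2 := tri u q' y
  have hq' := ih (t - 1) (by omega) q' (by omega) (by omega)
  by_cases ht2 : t = 1
  · obtain rfl : q' = y := hG.1.dist_eq_zero_iff.1 (by omega)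
    have t3 := tri u q x
    have c1 := comm q' x
    refine ⟨q', x, hqq', by omega, ?_, by omega, by omega, Or.inl ⟨ht2, rfl, rfl⟩⟩
    by_contra h
    exact hno q (by omega) (by omega) (by omega)
  · obtain ⟨q'', h1, h2⟩ := exists_between hG.1 (u := q') (v := y) (i := 1) (by omega)
    have t3 := tri u q' q''
    have t4 := tri u q'' y
    have t5 := tri u q q''
    have := ih (t - 2) (by omega) q'' (by omega) (by omega)
    exact ⟨q', q'', hqq', h1, by omega, by omega, by omega, Or.inr ⟨by omega, by omega⟩⟩

/-- Let the edge `x y` violate the triangle condition. The distance from `p`, between `u` and `x`, keeps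
growing along every geodesic from `y` to `u` until it reaches `k`. -/
lemma dist_interval_of_no_common (hG : IsBridged G) (hP : ∀ j < k, TriangleCondition G j)
    (hQ : ∀ j ≤ k, IntervalCliqueCondition G j) {u x y : V} (hx : G.dist u x = k)
    (hy : G.dist u y = k) (hxy : G.dist x y = 1)
    (hno : ∀ w, G.dist w x = 1 → G.dist w y = 1 → G.dist u w + 1 ≠ k)
    {p : V} {i : ℕ} (hi : 1 ≤ i) (hup : G.dist u p = i) (hpx : G.dist p x + i = k) :
    ∀ t, t < i → ∀ q, G.dist u q + t = k → G.dist q y = t → G.dist p q + i = k + 1 + t := by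
  have tri := fun a b c : V => hG.1.dist_triangle (u := a) (v := b) (w := c)
  have comm := fun a b : V => SimpleGraph.dist_comm (G := G) (u := a) (v := b)
  intro t
  induction t using Nat.strong_induction_on with
  | _ t ih =>
    intro hti q huq hqy
    by_cases ht1 : t = 0
    · obtain rfl : q = y := hG.1.dist_eq_zero_iff.1 (by omega)
      have := dist_of_no_common hG hP hx hy hxy hno hi hup hpx
      omega
    obtain ⟨q', q'', hqq', hq'q'', hqq'', hq', hq'', hcase⟩ :=
      exists_two_of_no_common hG hx hy hxy hno hpx (by omega)
        (fun s hs => ih s hs (by omega)) huq hqy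
    have t4 := tri p q q'
    have t5 := tri p q' q
    have c1 := comm q q'
    by_contra hne
    rcases (by omega : G.dist p q + 1 = G.dist p q' ∨ G.dist p q = G.dist p q') with h | h
    · have := hQ (G.dist p q') (by omega) p q' q q'' rfl (by omega) (by omega) (by omega) (by omega)
      omega
    · obtain ⟨w, hwq, hwq', hw⟩ :=
        hP (G.dist p q') (by omega) p q q' (by omega) (by omega) rfl (by omega)
      have hwq'' := hQ (G.dist p q') (by omega) p q' w q'' rfl (by rw [comm]; omega) (by omega)
        (by omega) (by omega)
      have t6 := tri u q w
      have t7 := tri u w q''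
      have c2 := comm q w
      rcases hcase with ⟨rfl, rfl, rfl⟩ | ⟨huq'', hq''y⟩
      · have c3 := comm q'' w
        have c4 := comm q w
        have c5 := comm q' q
        have t8 := tri u p w
        have t9 := tri q w q''
        have hwx : G.dist w q'' = 1 := by omega
        have huw : G.dist u w = k := by
          have := hno w hwx hwq'
          omega
        by_cases hno' : ∀ s, G.dist s q'' = 1 → G.dist s w = 1 → G.dist u s + 1 ≠ k
        · have := dist_of_no_common hG hP hx huw (by omega) hno' hi hup hpx
          omega
        · push Not at hno'
          obtain ⟨s, hs1, hs2, hs3⟩ := hno'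
          have hsq := hQ k le_rfl u w s q huw (by rw [comm]; omega) (by omega) hs3 (by omega)
          have c6 := comm q'' s
          have c7 := comm q'' q
          -- the square formed by the edge, `s` and `q`
          rcases hG.diagonal_four (a := q'') (b := s) (c := q) (d := q') (by omega) hsq (by omega)
            (by omega) with h | h
          · omega
          · have t10 := tri u s q'
            exact hno s hs1 (by omega) hs3
      · have t8 := tri w q'' y
        have t9 := tri u w y
        have := ih (t - 1) (by omega) (by omega) w (by omega) (by omega)
        omega

/-- A shortest violation of the triangle condition spans an isometric cycle of length `2 * k + 1`. -/
lemma triangle_condition_step (hG : IsBridged G) (hP : ∀ j < k, TriangleCondition G j)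
    (hQ : ∀ j ≤ k, IntervalCliqueCondition G j) : TriangleCondition G k := by
  intro u x y hk1 hx hy hxy
  have tri := fun a b c : V => hG.1.dist_triangle (u := a) (v := b) (w := c)
  have comm := fun a b : V => SimpleGraph.dist_comm (G := G) (u := a) (v := b)
  by_contra! hno
  obtain ⟨a, a0, a1, ha⟩ := exists_geodesic hG.1 u x
  obtain ⟨b, b0, b1, hb⟩ := exists_geodesic hG.1 u y
  have hk : 2 ≤ k := by
    have := hno u
    have : G.dist u u = 0 := SimpleGraph.dist_self
    by_contra h
    exact hno u (by omega) (by omega) (by omega)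
  have hau : ∀ i, i ≤ k → G.dist u (a i) = i := fun i hi => by
    have := ha 0 i (by omega) (by omega); rw [a0] at this; omega
  have hax : ∀ i, i ≤ k → G.dist (a i) x + i = k := fun i hi => by
    have := ha i _ (by omega : i ≤ G.dist u x) le_rfl; rw [a1] at this; omega
  have hbu : ∀ i, i ≤ k → G.dist u (b i) = i := fun i hi => by
    have := hb 0 i (by omega) (by omega); rw [b0] at this; omega
  have hby : ∀ i, i ≤ k → G.dist (b i) y + i = k := fun i hi => by
    have := hb i _ (by omega : i ≤ G.dist u y) le_rfl; rw [b1] at this; omega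
  have hab : ∀ i j, 1 ≤ i → 1 ≤ j → i ≤ k → j ≤ k →
      G.dist (a i) (b j) = min (i + j) (2 * k + 1 - (i + j)) := by
    intro i j hi hj hik hjk
    have t1 := tri (a i) u (b j)
    have t2 := tri (a i) x (b j)
    have t3 := tri x y (b j)
    have c1 := comm (a i) u
    have c2 := comm y (b j)
    have e1 := hau i hik
    have e2 := hbu j hjk
    have e3 := hax i hik
    have e4 := hby j hjk
    have key := dist_interval_of_no_common hG hP hQ hx hy hxy hno hi (hau i hik) (hax i hik)
    by_cases hij : k < i + j
    · have := key (k - j) (by omega) (b j) (by omega) (by omega)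
      omega
    · have h1 := hbu (k - i) (by omega)
      have h2 := hby (k - i) (by omega)
      obtain ⟨q', q'', hqq', hq'q'', hqq'', hq', hq'', -⟩ :=
        exists_two_of_no_common hG hx hy hxy hno (hax i hik) hi key
          (q := b (k - i)) (by omega) (by omega)
      have h3 := hb j (k - i) (by omega) (by omega)
      have h4 := tri (a i) (b j) (b (k - i))
      have h5 := tri (a i) (b (k - i)) q'
      have c3 := comm (b (k - i)) q'
      by_cases h6 : G.dist (a i) (b (k - i)) + 1 = k
      · have := hQ k le_rfl (a i) q' (b (k - i)) q'' (by omega) (by omega) (by omega) (by omega)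
          (by omega)
        omega
      · omega
  have := hG.2 (2 * k + 1) (by omega) (containsIsometric_cycleGraph
    (fun m => if m ≤ k then a m else b (2 * k + 1 - m)) (by
      intro i j hij hj
      split_ifs
      · rw [ha i j (by omega) (by omega)]; omega
      · rcases Nat.eq_zero_or_pos i with rfl | hi
        · rw [a0, hbu _ (by omega)]; omega
        · rw [hab i _ hi (by omega) (by omega) (by omega)]; omega
      · omega
      · rw [comm, hb (2 * k + 1 - j) (2 * k + 1 - i) (by omega) (by omega)]; omega))
  omega

end Inductive

/-- A shortest violation of either condition would span an isometric cycle. -/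
lemma IsBridged.conditions (hG : IsBridged G) (k : ℕ) :
    TriangleCondition G k ∧ IntervalCliqueCondition G k := by
  induction k using Nat.strong_induction_on with
  | _ k ih =>
    have hQ := interval_clique_step hG (fun j hj => (ih j hj).1) (fun j hj => (ih j hj).2)
    refine ⟨triangle_condition_step hG (fun j hj => (ih j hj).1) (fun j hj => ?_), hQ⟩
    rcases Nat.lt_or_eq_of_le hj with h | rfl
    · exact (ih j h).2
    · exact hQ

lemma IsBridged.exists_below (hG : IsBridged G) {u x y : V} (h : G.dist u x = G.dist u y)
    (h1 : 1 ≤ G.dist u x) (hxy : G.dist x y = 1) :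
    ∃ w, G.dist w x = 1 ∧ G.dist w y = 1 ∧ G.dist u w + 1 = G.dist u x :=
  (hG.conditions _).1 u x y h1 rfl h.symm hxy

lemma IsBridged.dist_below_le_one (hG : IsBridged G) {u x y z : V} (hxy : G.dist x y = 1)
    (hxz : G.dist x z = 1) (hy : G.dist u y + 1 = G.dist u x) (hz : G.dist u z + 1 = G.dist u x) :
    G.dist y z ≤ 1 :=
  (hG.conditions _).2 u x y z rfl hxy hxz hy hz

/-- Balls in a bridged graph are convex. -/
lemma IsBridged.dist_le_max (hG : IsBridged G) {u a b c : V} {r : ℕ}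
    (hc : G.dist a c + G.dist c b = G.dist a b) (ha : G.dist u a ≤ r) (hb : G.dist u b ≤ r) :
    G.dist u c ≤ r := by
  have tri := fun a b c : V => hG.1.dist_triangle (u := a) (v := b) (w := c)
  have comm := fun a b : V => SimpleGraph.dist_comm (G := G) (u := a) (v := b)
  induction hD : G.dist a b using Nat.strong_induction_on generalizing a b c r with
  | _ D ih =>
    by_contra! hlt
    have hac : 1 ≤ G.dist a c := by
      by_contra h
      obtain rfl : a = c := hG.1.dist_eq_zero_iff.1 (by omega)
      omega
    have hcb : 1 ≤ G.dist c b := by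
      by_contra h
      obtain rfl : c = b := hG.1.dist_eq_zero_iff.1 (by omega)
      omega
    -- every vertex strictly between `a` and `b` on a geodesic through `c` has height `r + 1`
    obtain ⟨e, hae, hec⟩ := exists_between hG.1 hac
    have t1 := tri e c b
    have t2 := tri a e b
    have hue : G.dist u e = r + 1 := by
      have t3 := tri u a e
      by_contra h
      have := ih (G.dist e b) (by omega) (a := e) (b := b) (c := c) (by omega) (by omega) hb rfl
      omega
    have hplateau : ∀ f, G.dist e f + G.dist f b = G.dist e b → f ≠ b → G.dist u f = r + 1 := by
      intro f hf hfb
      have h1 := ih (G.dist e b) (by omega) (a := e) (b := b) (c := f) (r := r + 1) hf (by omega)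
        (by omega) rfl
      have h2 : 0 < G.dist f b := hG.1.pos_dist_of_ne hfb
      have t3 := tri a e f
      have t4 := tri a f b
      by_contra h
      have := ih (G.dist a f) (by omega) (a := a) (b := f) (c := e) (r := r) (by omega) ha
        (by omega) rfl
      omega
    have heb : 1 ≤ G.dist e b := by omega
    obtain ⟨f, hef, hfb⟩ := exists_between hG.1 heb
    have t3 := tri a f b
    have t4 := tri a e f
    have hua : G.dist u a = r := by
      have := tri u a e
      omega
    have caee := comm a e
    by_cases hfb' : f = b
    · subst hfb'
      have : G.dist u f = r := by
        have := tri u f e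
        have := comm e f
        omega
      have := hG.dist_below_le_one (u := u) (x := e) (y := a) (z := f) (by omega) hef (by omega)
        (by omega)
      omega
    · have huf := hplateau f (by omega) hfb'
      obtain ⟨w, hwe, hwf, huw⟩ := hG.exists_below (u := u) (x := e) (y := f) (by omega) (by omega)
        hef
      have cwe := comm e w
      have haw := hG.dist_below_le_one (u := u) (x := e) (y := a) (z := w) (by omega) (by omega)
        (by omega) (by omega)
      have t5 := tri a w b
      have t6 := tri w f b
      have t7 := tri a w f
      have := ih (G.dist w b) (by omega) (a := w) (b := b) (c := f) (r := r) (by omega) (by omega) hb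
        rfl
      omega

end Bridged

/-! ### Levels of intervals -/

section Levels

variable {V : Type*} {G : SimpleGraph V}

/-- A convex set `S` of vertices and a set `T` next to it such that cliques of at most three
vertices on either side have a common neighbour on the other side, and the neighbours on the other
side of any vertex form a clique. Two consecutive levels of an interval of a bridged graph are of
this kind. Cliques are described by `dist ≤ 1`, which allows repeated vertices. -/
structure IsSandwich (G : SimpleGraph V) (S T : Set V) : Prop where
  convex : ∀ ⦃a b c⦄, a ∈ S → b ∈ S → G.dist a c + G.dist c b = G.dist a b → c ∈ S
  down : ∀ ⦃a b c⦄, a ∈ S → b ∈ S → c ∈ S → G.dist a b ≤ 1 → G.dist b c ≤ 1 → G.dist a c ≤ 1 →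
    ∃ x ∈ T, G.dist x a = 1 ∧ G.dist x b = 1 ∧ G.dist x c = 1
  up : ∀ ⦃x y z⦄, x ∈ T → y ∈ T → z ∈ T → G.dist x y ≤ 1 → G.dist y z ≤ 1 → G.dist x z ≤ 1 →
    ∃ a ∈ S, G.dist x a = 1 ∧ G.dist y a = 1 ∧ G.dist z a = 1
  down_clique : ∀ ⦃a x y⦄, a ∈ S → x ∈ T → y ∈ T → G.dist x a ≤ 1 → G.dist y a ≤ 1 →
    G.dist x y ≤ 1
  up_clique : ∀ ⦃x a b⦄, x ∈ T → a ∈ S → b ∈ S → G.dist x a ≤ 1 → G.dist x b ≤ 1 →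
    G.dist a b ≤ 1

lemma mem_levelSet_swap {u v x : V} {k l : ℕ} (hkl : k + l = G.dist u v)
    (hx : x ∈ levelSet G u v k) : x ∈ levelSet G v u l := by
  obtain ⟨h1, h2⟩ := hx
  have h1 : G.dist u x + G.dist x v = G.dist u v := h1
  have c1 := SimpleGraph.dist_comm (G := G) (u := u) (v := v)
  have c2 := SimpleGraph.dist_comm (G := G) (u := u) (v := x)
  have c3 := SimpleGraph.dist_comm (G := G) (u := x) (v := v)
  refine ⟨?_, by omega⟩
  change G.dist v x + G.dist x u = G.dist v u
  omega

lemma mem_levelSet_iff {u v x : V} {k : ℕ} :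
    x ∈ levelSet G u v k ↔ G.dist u x = k ∧ k + G.dist x v = G.dist u v :=
  ⟨fun ⟨h1, h2⟩ => ⟨h2, by rw [← h2]; exact h1⟩,
    fun ⟨h1, h2⟩ => ⟨show G.dist u x + G.dist x v = G.dist u v by rw [h1]; exact h2, h1⟩⟩

lemma levelSet_convex (hG : IsBridged G) {u v : V} {k : ℕ} {a b c : V}
    (ha : a ∈ levelSet G u v k) (hb : b ∈ levelSet G u v k)
    (hc : G.dist a c + G.dist c b = G.dist a b) : c ∈ levelSet G u v k := by
  rw [mem_levelSet_iff] at *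
  have h1 := hG.dist_le_max (u := u) (r := k) hc (by omega) (by omega)
  have c1 := SimpleGraph.dist_comm (G := G) (u := v) (v := a)
  have c2 := SimpleGraph.dist_comm (G := G) (u := v) (v := b)
  have c3 := SimpleGraph.dist_comm (G := G) (u := v) (v := c)
  have h2 := hG.dist_le_max (u := v) (r := G.dist u v - k) hc (by omega) (by omega)
  have h3 := hG.1.dist_triangle (u := u) (v := c) (w := v)
  omega

lemma mem_levelSet_of_below (hG : G.Connected) {u v a x : V} {k : ℕ}
    (ha : a ∈ levelSet G u v (k + 1)) (hxa : G.dist x a ≤ 1) (hx : G.dist u x ≤ k) :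
    x ∈ levelSet G u v k := by
  rw [mem_levelSet_iff] at *
  have h1 := hG.dist_triangle (u := u) (v := x) (w := a)
  have h2 := hG.dist_triangle (u := x) (v := a) (w := v)
  have h3 := hG.dist_triangle (u := u) (v := x) (w := v)
  omega

/-- A clique of at most three vertices at distance `k + 1` from `u` has a common neighbour at
distance `k` from `u`. -/
lemma IsBridged.exists_below_three (hG : IsBridged G) {u a b c : V} {k : ℕ}
    (ha : G.dist u a = k + 1) (hb : G.dist u b = k + 1) (hc : G.dist u c = k + 1)
    (hab : G.dist a b ≤ 1) (hbc : G.dist b c ≤ 1) (hac : G.dist a c ≤ 1) :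
    ∃ x, G.dist u x = k ∧ G.dist x a = 1 ∧ G.dist x b = 1 ∧ G.dist x c = 1 := by
  have tri := fun a b c : V => hG.1.dist_triangle (u := a) (v := b) (w := c)
  have comm := fun a b : V => SimpleGraph.dist_comm (G := G) (u := a) (v := b)
  have two : ∀ a b, G.dist u a = k + 1 → G.dist u b = k + 1 → G.dist a b ≤ 1 →
      ∃ x, G.dist u x = k ∧ G.dist x a = 1 ∧ G.dist x b = 1 := by
    intro a b ha hb hab
    by_cases h : G.dist a b = 0
    · obtain rfl := hG.1.dist_eq_zero_iff.1 h
      obtain ⟨x, h1, h2⟩ := exists_between hG.1 (by omega : k ≤ G.dist u a)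
      exact ⟨x, h1, by omega, by omega⟩
    · obtain ⟨x, h1, h2, h3⟩ := hG.exists_below (u := u) (x := a) (y := b) (by omega) (by omega)
        (by omega)
      exact ⟨x, by omega, h1, h2⟩
  obtain ⟨s, hs, hsa, hsb⟩ := two a b ha hb hab
  obtain ⟨t, ht, htb, htc⟩ := two b c hb hc hbc
  have hst := hG.dist_below_le_one (u := u) (x := b) (y := s) (z := t) (by rw [comm]; exact hsb)
    (by rw [comm]; exact htb) (by omega) (by omega)
  have c1 := comm a s
  have c2 := comm c a
  rcases hG.diagonal_four (a := a) (b := s) (c := t) (d := c) (by omega) hst (by omega) (by omega)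
    with h | h
  · have := tri u t a
    have := comm a t
    exact ⟨t, ht, by omega, htb, htc⟩
  · have := tri u s c
    exact ⟨s, hs, hsa, hsb, by omega⟩

/-- Consecutive levels form a sandwich. -/
lemma IsBridged.isSandwich_levelSet (hG : IsBridged G) {u v : V} {k : ℕ}
    (hk : k + 1 ≤ G.dist u v) : IsSandwich G (levelSet G u v (k + 1)) (levelSet G u v k) := by
  have tri := fun a b c : V => hG.1.dist_triangle (u := a) (v := b) (w := c)
  have comm := fun a b : V => SimpleGraph.dist_comm (G := G) (u := a) (v := b)
  refine ⟨fun a b c ha hb hc => levelSet_convex hG ha hb hc, ?_, ?_, ?_, ?_⟩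
  · intro a b c ha hb hc hab hbc hac
    obtain ⟨x, hx, hxa, hxb, hxc⟩ := hG.exists_below_three (u := u) (mem_levelSet_iff.1 ha).1
      (mem_levelSet_iff.1 hb).1 (mem_levelSet_iff.1 hc).1 hab hbc hac
    exact ⟨x, mem_levelSet_of_below hG.1 ha (by omega) hx.le, hxa, hxb, hxc⟩
  · intro x y z hx hy hz hxy hyz hxz
    obtain ⟨l, hl⟩ : ∃ l, k + 1 + l = G.dist u v := ⟨_, Nat.add_sub_of_le hk⟩
    have hx' := mem_levelSet_swap (l := l + 1) (by omega) hx
    have hy' := mem_levelSet_swap (l := l + 1) (by omega) hy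
    have hz' := mem_levelSet_swap (l := l + 1) (by omega) hz
    obtain ⟨a, ha, hax, hay, haz⟩ := hG.exists_below_three (u := v) (mem_levelSet_iff.1 hx').1
      (mem_levelSet_iff.1 hy').1 (mem_levelSet_iff.1 hz').1 hxy hyz hxz
    refine ⟨a, mem_levelSet_swap (k := l) (by rw [comm]; omega)
      (mem_levelSet_of_below hG.1 hx' (by omega) ha.le), ?_, ?_, ?_⟩ <;> rw [comm] <;> assumption
  · intro a x y ha hx hy hxa hya
    rw [mem_levelSet_iff] at *
    have := tri u x a
    have := tri u y a
    have := comm x a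
    have := comm y a
    exact hG.dist_below_le_one (u := u) (x := a) (y := x) (z := y) (by omega) (by omega) (by omega)
      (by omega)
  · intro x a b hx ha hb hxa hxb
    rw [mem_levelSet_iff] at *
    have := tri u x a
    have := tri u x b
    have := comm x v
    have := comm a v
    have := comm b v
    exact hG.dist_below_le_one (u := v) (x := x) (y := a) (z := b) (by omega) (by omega) (by omega)
      (by omega)

/-- Levels are isometrically embedded. -/
lemma level_reachable_and_dist (hG : IsBridged G) {u v : V} {k : ℕ} (a b : levelSet G u v k) :
    (level G u v k).Reachable a b ∧ (level G u v k).dist a b = G.dist a.1 b.1 := by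
  refine dist_eq_of_descent (level G u v k) b (fun a => G.dist a.1 b.1) (by simp) ?_ ?_ a
  · intro x x' h
    have h1 : G.dist x.1 x'.1 = 1 := SimpleGraph.dist_eq_one_iff_adj.2 h
    have := hG.1.dist_triangle (u := x.1) (v := x'.1) (w := b.1)
    omega
  · intro x hx
    have hpos : 1 ≤ G.dist x.1 b.1 := hG.1.pos_dist_of_ne (fun h => hx (Subtype.ext h))
    obtain ⟨w, h1, h2⟩ := exists_between hG.1 hpos
    refine ⟨⟨w, levelSet_convex hG x.2 b.2 (by omega)⟩, ?_, ?_⟩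
    · exact (SimpleGraph.dist_eq_one_iff_adj.1 h1 : G.Adj x.1 w)
    · simp only; omega

lemma level_dist (hG : IsBridged G) {u v : V} {k : ℕ} (a b : levelSet G u v k) :
    (level G u v k).dist a b = G.dist a.1 b.1 :=
  (level_reachable_and_dist hG a b).2

end Levels

/-! ### Medians in levels -/

section Medians

variable {V : Type*} {G : SimpleGraph V}

/-- If `m` is the only vertex of `I(x, m)` nearest to `z`, then `m` lies between `x` and `z`. -/
lemma IsBridged.dist_eq_add_of_nearest (hG : IsBridged G) {x m z : V} {l : ℕ}
    (hm : G.dist z m = l)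
    (hmin : ∀ q, G.dist x q + G.dist q m = G.dist x m → q ≠ m → l < G.dist z q) :
    G.dist z x = G.dist x m + l := by
  have tri := fun a b c : V => hG.1.dist_triangle (u := a) (v := b) (w := c)
  have comm := fun a b : V => SimpleGraph.dist_comm (G := G) (u := a) (v := b)
  have key : ∀ s q, G.dist x q + s = G.dist x m → G.dist q m = s → G.dist z q = l + s := by
    intro s
    induction s using Nat.strong_induction_on with
    | _ s ih =>
      intro q hxq hqm
      by_cases hs0 : s = 0
      · obtain rfl : q = m := hG.1.dist_eq_zero_iff.1 (by omega)
        omega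
      have hne : q ≠ m := fun h => by
        have : G.dist q m = 0 := by rw [h]; simp
        omega
      have hlt := hmin q (by omega) hne
      have t1 := tri z m q
      have c1 := comm q m
      by_cases hs1 : s = 1
      · omega
      obtain ⟨q', h1, h2⟩ := exists_between hG.1 (by omega : 1 ≤ G.dist q m)
      have t2 := tri x q q'
      have t3 := tri x q' m
      obtain ⟨q'', h3, h4⟩ := exists_between hG.1 (by omega : 1 ≤ G.dist q' m)
      have t4 := tri x q' q''
      have t5 := tri x q'' m
      have e1 := ih (s - 1) (by omega) q' (by omega) (by omega)
      have e2 := ih (s - 2) (by omega) q'' (by omega) (by omega)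
      have t6 := tri z q q'
      have t7 := tri z q' q
      have c2 := comm q q'
      have t8 := tri x q q''
      by_contra hcon
      rcases (by omega : G.dist z q + 1 = G.dist z q' ∨ G.dist z q = G.dist z q') with h | h
      · have := hG.dist_below_le_one (u := z) (x := q') (y := q) (z := q'') (by omega) h3 h
          (by omega)
        omega
      · obtain ⟨w, hwq, hwq', hw⟩ := hG.exists_below (u := z) h (by omega) h1
        have c3 := comm q' w
        have c4 := comm q w
        have hwq'' := hG.dist_below_le_one (u := z) (x := q') (y := w) (z := q'') (by omega) h3
          (by omega) (by omega)
        have t9 := tri x q w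
        have t10 := tri x w q''
        have t11 := tri w q'' m
        have t12 := tri x w m
        have := ih (s - 1) (by omega) w (by omega) (by omega)
        omega
  have := key (G.dist x m) x (by simp) rfl
  omega

namespace IsSandwich

variable {S T : Set V}

lemma down_two (h : IsSandwich G S T) {a b : V} (ha : a ∈ S) (hb : b ∈ S) (hab : G.dist a b ≤ 1) :
    ∃ x ∈ T, G.dist x a = 1 ∧ G.dist x b = 1 := by
  obtain ⟨x, hx, h1, h2, -⟩ := h.down ha hb hb hab (by simp) hab
  exact ⟨x, hx, h1, h2⟩

lemma up_two (h : IsSandwich G S T) {x y : V} (hx : x ∈ T) (hy : y ∈ T) (hxy : G.dist x y ≤ 1) :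
    ∃ a ∈ S, G.dist x a = 1 ∧ G.dist y a = 1 := by
  obtain ⟨a, ha, h1, h2, -⟩ := h.up hx hy hy hxy (by simp) hxy
  exact ⟨a, ha, h1, h2⟩

/-- A geodesic of length two in `S` at constant distance from `z` can be pushed towards `z`. This
excludes metric triangles of side two. -/
lemma exists_closer (hS : IsSandwich G S T) (hG : IsBridged G) {z p q r : V} (hz : z ∈ S)
    (hp : p ∈ S) (hq : q ∈ S) (hr : r ∈ S) (hpq : G.dist p q = 1) (hqr : G.dist q r = 1)
    (hpr : G.dist p r = 2) (hzp : G.dist z p = G.dist z q) (hzr : G.dist z r = G.dist z q) :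
    ∃ w, G.dist w p = 1 ∧ G.dist w r = 1 ∧ G.dist z w < G.dist z q := by
  have tri := fun a b c : V => hG.1.dist_triangle (u := a) (v := b) (w := c)
  have comm := fun a b : V => SimpleGraph.dist_comm (G := G) (u := a) (v := b)
  have hpos : 1 ≤ G.dist z q := by
    have := tri p z q
    have := comm p z
    omega
  have hmem : ∀ w a, a ∈ S → G.dist w a = 1 → G.dist z w + 1 = G.dist z a → w ∈ S :=
    fun w a ha h1 h2 => hS.convex hz ha (by omega)
  obtain ⟨w, hwp, hwq, hw⟩ := hG.exists_below hzp (by omega) hpq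
  obtain ⟨w', hwq', hwr', hw'⟩ := hG.exists_below hzr.symm (by omega) hqr
  have cwq := comm w q
  have cwq' := comm w' q
  have hww := hG.dist_below_le_one (u := z) (x := q) (y := w) (z := w') (by omega) (by omega)
    (by omega) (by omega)
  by_cases h0 : G.dist w w' = 0
  · obtain rfl := hG.1.dist_eq_zero_iff.1 h0
    exact ⟨w, hwp, hwr', by omega⟩
  by_cases hl : G.dist z w = 0
  · have := tri w z w'
    have := comm w z
    omega
  have hwS := hmem w q hq hwq (by omega)
  have hwS' := hmem w' q hq hwq' (by omega)
  obtain ⟨t, htw, htw', ht⟩ := hG.exists_below (u := z) (x := w) (y := w') (by omega) (by omega)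
    (by omega)
  have htS := hmem t w hwS htw (by omega)
  have cwp := comm w p
  have cwt := comm w t
  have cwr := comm w' r
  have ctw := comm w' t
  -- the corners of a triangle of side two are joined by a common neighbour
  obtain ⟨x, hxT, hxp, hxq, hxw⟩ := hS.down hp hq hwS (by omega) (by omega) (by omega)
  obtain ⟨y, hyT, hyr, hyq, hyw⟩ := hS.down hr hq hwS' (by rw [comm]; omega) (by omega) (by omega)
  obtain ⟨s, hsT, hst, hsw, hsw'⟩ := hS.down htS hwS hwS' (by omega) (by omega) (by omega)
  obtain ⟨g, hgS, hxg, hyg, hsg⟩ := hS.up hxT hyT hsT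
    (hS.down_clique hq hxT hyT (by omega) (by omega))
    (hS.down_clique hwS' hyT hsT (by omega) (by omega))
    (hS.down_clique hwS hxT hsT (by omega) (by omega))
  have hgp := hS.up_clique hxT hgS hp (by omega) (by omega)
  have hgr := hS.up_clique hyT hgS hr (by omega) (by omega)
  have hgt := hS.up_clique hsT hgS htS (by omega) (by omega)
  have t1 := tri p g r
  have t2 := tri z t g
  have c1 := comm p g
  have c2 := comm t g
  exact ⟨g, by omega, by omega, by omega⟩

/-- Vertices of `I(x, y)` at the same distance from `x` are adjacent or equal. -/
lemma interval_clique (hS : IsSandwich G S T) (hG : IsBridged G) {x y p q : V} (hx : x ∈ S)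
    (hy : y ∈ S) (hp : G.dist x p + G.dist p y = G.dist x y)
    (hq : G.dist x q + G.dist q y = G.dist x y) (hpq : G.dist x p = G.dist x q) :
    G.dist p q ≤ 1 := by
  have tri := fun a b c : V => hG.1.dist_triangle (u := a) (v := b) (w := c)
  have comm := fun a b : V => SimpleGraph.dist_comm (G := G) (u := a) (v := b)
  by_contra! h
  have hp' : p ∈ levelSet G x y (G.dist x p) := ⟨hp, rfl⟩
  have hq' : q ∈ levelSet G x y (G.dist x p) := ⟨hq, hpq.symm⟩
  obtain ⟨r, hpr, hrq⟩ := exists_between hG.1 (by omega : 2 ≤ G.dist p q)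
  have hr' := levelSet_convex hG hp' hq' (c := r) (by omega)
  obtain ⟨w, hpw, hwr⟩ := exists_between hG.1 (by omega : 1 ≤ G.dist p r)
  have hw' := levelSet_convex hG hp' hr' (c := w) (by omega)
  rw [mem_levelSet_iff] at hr' hw'
  have hj : 1 ≤ G.dist x p := by
    have := tri p x q
    have := comm p x
    omega
  have hj' : 1 ≤ G.dist p y := by
    have := tri p y q
    have := comm y q
    omega
  have cpy := comm p y
  have crw := comm w y
  have crr := comm r y
  obtain ⟨a, hap, haw, ha⟩ := hG.exists_below (u := x) (x := p) (y := w) (by omega) (by omega) hpw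
  obtain ⟨c, hcp, hcw, hc⟩ := hG.exists_below (u := y) (x := p) (y := w) (by omega) (by omega) hpw
  obtain ⟨e, hew, her, he⟩ := hG.exists_below (u := y) (x := w) (y := r) (by omega) (by omega)
    (by omega)
  have hIS : ∀ s, G.dist x s + G.dist s y = G.dist x y → s ∈ S := fun s hs => hS.convex hx hy hs
  have t1 := tri x c y
  have t2 := tri x p c
  have t3 := tri x e y
  have t4 := tri x w e
  have t5 := tri x a y
  have t6 := tri a p y
  have c1 := comm c y
  have c2 := comm e y
  have c3 := comm c p
  have c4 := comm e w
  have c5 := comm c w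
  have hpS := hIS p (by omega)
  have hwS := hIS w (by omega)
  have hrS := hIS r (by omega)
  have haS := hIS a (by omega)
  have hcS := hIS c (by omega)
  have heS := hIS e (by omega)
  obtain ⟨s, hsT, hsa, hsp, hsw⟩ := hS.down haS hpS hwS (by omega) (by omega) (by omega)
  obtain ⟨t, htT, hte, htr, htw⟩ := hS.down heS hrS hwS (by omega) (by rw [comm]; omega) (by omega)
  have hst := hS.down_clique hwS hsT htT (by omega) (by omega)
  have hec := hG.dist_below_le_one (u := y) (x := w) (y := e) (z := c) (by omega) (by omega)
    (by omega) (by omega)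
  have hpr_of : ∀ f, G.dist x f = G.dist x p + 1 → G.dist f p ≤ 1 → G.dist f r ≤ 1 → False := by
    intro f hf h1 h2
    have := tri x p f
    have := tri x r f
    have := comm p f
    have := comm r f
    have := hG.dist_below_le_one (u := x) (x := f) (y := p) (z := r) (by omega) (by omega) (by omega)
      (by omega)
    omega
  have c6 := comm p s
  have c7 := comm t e
  have c8 := comm p e
  have c9 := comm p t
  have ac := tri x a c
  have ae := tri x a e
  -- the pentagon `p s t e c`
  rcases hG.diagonal_five (a := p) (b := s) (c := t) (d := e) (e := c) (by omega) hst (by omega)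
    hec (by omega) with h | h | h | h | h
  · have := hS.up_clique htT hpS hrS (by omega) (by omega)
    omega
  · exact hpr_of e (by omega) (by omega) (by omega)
  · have := hS.up_clique hsT haS heS (by omega) (by omega)
    omega
  · have := hS.up_clique hsT haS hcS (by omega) (by omega)
    omega
  · have := hS.up_clique htT hcS hrS (by omega) (by omega)
    exact hpr_of c (by omega) (by omega) (by omega)

/-- Of the vertices of `I(x, y)` which are nearest to `z`, those on a geodesic from `x` to `y`
span at most an edge. -/
lemma dist_le_one_of_nearest (hS : IsSandwich G S T) (hG : IsBridged G) {x y z m0 m' : V}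
    (hx : x ∈ S) (hy : y ∈ S) (hz : z ∈ S) (h0 : G.dist x m0 + G.dist m0 y = G.dist x y)
    (hI' : G.dist x m' + G.dist m' y = G.dist x y)
    (h0' : G.dist x m0 + G.dist m0 m' = G.dist x m') {l : ℕ} (hl0 : G.dist z m0 = l)
    (hz' : G.dist z m' = l)
    (hlmin : ∀ m, G.dist x m + G.dist m y = G.dist x y → l ≤ G.dist z m) :
    G.dist m0 m' ≤ 1 := by
  have tri := fun a b c : V => hG.1.dist_triangle (u := a) (v := b) (w := c)
  have comm := fun a b : V => SimpleGraph.dist_comm (G := G) (u := a) (v := b)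
  have hIS : ∀ s, G.dist x s + G.dist s y = G.dist x y → s ∈ S := fun s hs => hS.convex hx hy hs
  by_contra hne
  obtain ⟨r, e1, e2⟩ := exists_between hG.1 (by omega : 2 ≤ G.dist m0 m')
  obtain ⟨q, e3, e4⟩ := exists_between hG.1 (by omega : 1 ≤ G.dist m0 r)
  have t1 := tri x m0 r
  have t2 := tri r m' y
  have t3 := tri x r y
  have t4 := tri x m0 q
  have t5 := tri q r y
  have t6 := tri x q y
  have hr : G.dist x r + G.dist r y = G.dist x y := by omega
  have hq : G.dist x q + G.dist q y = G.dist x y := by omega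
  have hzr := hG.dist_le_max (u := z) (a := m0) (b := m') (c := r) (r := l) (by omega) (by omega)
    (by omega)
  have hzq := hG.dist_le_max (u := z) (a := m0) (b := r) (c := q) (r := l) (by omega) (by omega)
    (by omega)
  have hzr' := hlmin r hr
  have hzq' := hlmin q hq
  obtain ⟨w, hwm, hwr, hw⟩ := hS.exists_closer hG hz (hIS m0 h0) (hIS q hq) (hIS r hr) e3
    (by omega) e1 (by omega) (by omega)
  have c1 := comm w m0
  have t7 := tri x m0 w
  have t8 := tri w r y
  have t9 := tri x w y
  have := hlmin w (by omega)
  omega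

set_option maxHeartbeats 800000 in
/-- Any three vertices of `S` have a median vertex or a median triangle. -/
lemma exists_median (hS : IsSandwich G S T) (hG : IsBridged G) {x y z : V} (hx : x ∈ S)
    (hy : y ∈ S) (hz : z ∈ S) :
    (∃ m ∈ S, G.dist x m + G.dist m y = G.dist x y ∧ G.dist x m + G.dist m z = G.dist x z ∧
      G.dist y m + G.dist m z = G.dist y z) ∨
    (∃ a ∈ S, ∃ b ∈ S, ∃ c ∈ S, G.dist a b = 1 ∧ G.dist b c = 1 ∧ G.dist a c = 1 ∧
      G.dist x a + 1 + G.dist b y = G.dist x y ∧ G.dist x a + 1 + G.dist c z = G.dist x z ∧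
      G.dist y b + 1 + G.dist c z = G.dist y z) := by
  classical
  have tri := fun a b c : V => hG.1.dist_triangle (u := a) (v := b) (w := c)
  have comm := fun a b : V => SimpleGraph.dist_comm (G := G) (u := a) (v := b)
  -- `l` is the distance from `z` to the interval
  have hex : ∃ l m, G.dist x m + G.dist m y = G.dist x y ∧ G.dist z m = l :=
    ⟨_, x, by simp, rfl⟩
  obtain ⟨l, hl, hlmin⟩ : ∃ l, (∃ m, G.dist x m + G.dist m y = G.dist x y ∧ G.dist z m = l) ∧
      ∀ m, G.dist x m + G.dist m y = G.dist x y → l ≤ G.dist z m :=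
    ⟨Nat.find hex, Nat.find_spec hex, fun m hm => Nat.find_min' hex ⟨m, hm, rfl⟩⟩
  -- `m0` and `m1` are the nearest vertices which are closest to `x` and to `y`
  have hex0 : ∃ i m, G.dist x m + G.dist m y = G.dist x y ∧ G.dist z m = l ∧ G.dist x m = i := by
    obtain ⟨m, h1, h2⟩ := hl
    exact ⟨_, m, h1, h2, rfl⟩
  have hex1 : ∃ i m, G.dist x m + G.dist m y = G.dist x y ∧ G.dist z m = l ∧ G.dist m y = i := by
    obtain ⟨m, h1, h2⟩ := hl
    exact ⟨_, m, h1, h2, rfl⟩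
  obtain ⟨m0, h0, hl0, hmin0⟩ : ∃ m, G.dist x m + G.dist m y = G.dist x y ∧ G.dist z m = l ∧
      ∀ m', G.dist x m' + G.dist m' y = G.dist x y → G.dist z m' = l →
        G.dist x m ≤ G.dist x m' := by
    obtain ⟨m, h1, h2, h3⟩ := Nat.find_spec hex0
    exact ⟨m, h1, h2, fun m' h1' h2' => h3 ▸ Nat.find_min' hex0 ⟨m', h1', h2', rfl⟩⟩
  obtain ⟨m1, h1, hl1, hmin1⟩ : ∃ m, G.dist x m + G.dist m y = G.dist x y ∧ G.dist z m = l ∧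
      ∀ m', G.dist x m' + G.dist m' y = G.dist x y → G.dist z m' = l →
        G.dist m y ≤ G.dist m' y := by
    obtain ⟨m, h1, h2, h3⟩ := Nat.find_spec hex1
    exact ⟨m, h1, h2, fun m' h1' h2' => h3 ▸ Nat.find_min' hex1 ⟨m', h1', h2', rfl⟩⟩
  have hxz : G.dist z x = G.dist x m0 + l := hG.dist_eq_add_of_nearest hl0 fun q hq hne => by
    have t1 := tri q m0 y
    have t2 := tri x q y
    have hq' : G.dist x q + G.dist q y = G.dist x y := by omega
    have hpos := hG.1.pos_dist_of_ne hne
    rcases Nat.lt_or_eq_of_le (hlmin q hq') with h | h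
    · exact h
    · have := hmin0 q hq' h.symm
      omega
  have hyz : G.dist z y = G.dist y m1 + l := hG.dist_eq_add_of_nearest hl1 fun q hq hne => by
    have t1 := tri x m1 q
    have t2 := tri x q y
    have c1 := comm q m1
    have c2 := comm y q
    have c3 := comm y m1
    have hq' : G.dist x q + G.dist q y = G.dist x y := by omega
    have hpos := hG.1.pos_dist_of_ne hne
    rcases Nat.lt_or_eq_of_le (hlmin q hq') with h | h
    · exact h
    · have := hmin1 q hq' h.symm
      omega
  have h01 := hmin0 m1 h1 hl1
  have cxz := comm z x
  have cyz := comm z y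
  have cym1 := comm y m1
  have czm0 := comm z m0
  have cym0 := comm y m0
  have hIS : ∀ s, G.dist x s + G.dist s y = G.dist x y → s ∈ S := fun s hs => hS.convex hx hy hs
  by_cases heq : G.dist x m0 = G.dist x m1
  · left
    exact ⟨m0, hIS m0 h0, h0, by omega, by omega⟩
  right
  -- a nearest vertex on the level of `m1` which lies between `m0` and `y`
  obtain ⟨m', hI', hx', h0', hz'⟩ : ∃ m', G.dist x m' + G.dist m' y = G.dist x y ∧
      G.dist x m' = G.dist x m1 ∧ G.dist x m0 + G.dist m0 m' = G.dist x m1 ∧ G.dist z m' = l := by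
    have t1 := tri x m0 m1
    by_cases h : G.dist x m0 + G.dist m0 m1 = G.dist x m1
    · exact ⟨m1, h1, rfl, h, hl1⟩
    · obtain ⟨m', e1, e2⟩ := exists_between hG.1
        (by omega : G.dist x m1 - G.dist x m0 ≤ G.dist m0 y)
      have t2 := tri x m0 m'
      have t3 := tri x m' y
      have hI' : G.dist x m' + G.dist m' y = G.dist x y := by omega
      have h' := hS.interval_clique hG hx hy hI' h1 (by omega)
      have t4 := tri m0 m' m1
      have := hG.dist_le_max (u := z) (a := m0) (b := m1) (c := m') (r := l) (by omega) (by omega)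
        (by omega)
      have := hlmin m' hI'
      exact ⟨m', hI', by omega, by omega, by omega⟩
  have hone : G.dist m0 m' = 1 := by
    have := hS.dist_le_one_of_nearest hG hx hy hz h0 hI' (by omega) hl0 hz' hlmin
    omega
  have hl1 : 1 ≤ l := by
    by_contra h
    have := tri m0 z m'
    omega
  obtain ⟨c, hcm0, hcm', hc⟩ := hG.exists_below (u := z) (x := m0) (y := m') (by omega) (by omega)
    hone
  have cc := comm c z
  have cc0 := comm c m0
  have cc1 := comm c m'
  have cy' := comm y m'
  exact ⟨m0, hIS m0 h0, m', hIS m' hI', c, hS.convex hz (hIS m0 h0) (by omega), hone, by omega,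
    by omega, by omega, by omega, by omega⟩

/-- Two triangles attached along parallel edges of `I(x, y)` are close to each other. -/
lemma dist_le_two_of_parallel (hS : IsSandwich G S T) (hG : IsBridged G)
    {x y a b c a' b' c' : V} (hx : x ∈ S) (hy : y ∈ S) (hc : c ∈ S) (hc' : c' ∈ S)
    (ha : G.dist x a + G.dist a y = G.dist x y) (hb : G.dist x b + G.dist b y = G.dist x y)
    (ha' : G.dist x a' + G.dist a' y = G.dist x y) (hb' : G.dist x b' + G.dist b' y = G.dist x y)
    (haa : G.dist x a = G.dist x a') (hbb : G.dist x b = G.dist x b')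
    (hlt : G.dist x b = G.dist x a + 1)
    (hab : G.dist a b = 1) (hbc : G.dist b c = 1) (hac : G.dist a c = 1)
    (hab' : G.dist a' b' = 1) (hbc' : G.dist b' c' = 1) (hac' : G.dist a' c' = 1) :
    G.dist c c' ≤ 2 := by
  have tri := fun a b c : V => hG.1.dist_triangle (u := a) (v := b) (w := c)
  have comm := fun a b : V => SimpleGraph.dist_comm (G := G) (u := a) (v := b)
  have haa1 := hS.interval_clique hG hx hy ha ha' haa
  have hbb1 := hS.interval_clique hG hx hy hb hb' hbb
  have c1 := comm a c
  have c2 := comm b c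
  by_cases h0 : G.dist a a' = 0
  · obtain rfl := hG.1.dist_eq_zero_iff.1 h0
    have := tri c a c'
    omega
  by_cases h1 : G.dist b b' = 0
  · obtain rfl := hG.1.dist_eq_zero_iff.1 h1
    have := tri c b c'
    omega
  have hIS : ∀ s, G.dist x s + G.dist s y = G.dist x y → s ∈ S := fun s hs => hS.convex hx hy hs
  have cby := comm b y
  have cby' := comm b' y
  have hpa : 1 ≤ G.dist x a := by
    have := tri a x a'
    have := comm a x
    omega
  have hpb : 1 ≤ G.dist b y := by
    have := tri b y b'
    omega
  obtain ⟨p, hpa, hpa', hp⟩ := hG.exists_below haa (by omega) (by omega : G.dist a a' = 1)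
  obtain ⟨q, hqb, hqb', hq⟩ := hG.exists_below (u := y) (x := b) (y := b') (by omega) (by omega)
    (by omega)
  have t1 := tri p a y
  have t2 := tri x p y
  have t3 := tri x b q
  have t4 := tri x q y
  have cbq := comm b q
  have cqy := comm q y
  have hpS := hIS p (by omega)
  have hqS := hIS q (by omega)
  have haS := hIS a ha
  have hbS := hIS b hb
  have haS' := hIS a' ha'
  have hbS' := hIS b' hb'
  obtain ⟨X, hXT, hXp, hXa, hXa'⟩ := hS.down hpS haS haS' (by omega) (by omega) (by omega)
  obtain ⟨Y, hYT, hYq, hYb, hYb'⟩ := hS.down hqS hbS hbS' (by omega) (by omega) (by omega)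
  obtain ⟨Z, hZT, hZc, hZa, hZb⟩ := hS.down hc haS hbS (by omega) (by omega) (by omega)
  obtain ⟨W, hWT, hWc, hWa, hWb⟩ := hS.down hc' haS' hbS' (by rw [comm]; omega) (by omega)
    (by rw [comm]; omega)
  -- the lower neighbours of the four triangles form a square
  rcases hG.diagonal_four (hS.down_clique haS hXT hZT (by omega) (by omega))
    (hS.down_clique hbS hZT hYT (by omega) (by omega))
    (hS.down_clique hbS' hYT hWT (by omega) (by omega))
    (hS.down_clique haS' hWT hXT (by omega) (by omega)) with h | h
  · obtain ⟨g, hgS, hXg, hYg⟩ := hS.up_two hXT hYT h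
    have h1 := hS.up_clique hXT hgS hpS (by omega) (by omega)
    have h2 := hS.up_clique hYT hgS hqS (by omega) (by omega)
    have t5 := tri x p g
    have t6 := tri x g q
    have c3 := comm p g
    omega
  · obtain ⟨g, hgS, hZg, hWg⟩ := hS.up_two hZT hWT h
    have h1 := hS.up_clique hZT hgS hc (by omega) (by omega)
    have h2 := hS.up_clique hWT hgS hc' (by omega) (by omega)
    have t5 := tri c g c'
    have c3 := comm c g
    omega

end IsSandwich

end Medians

/-! ### Distances in tripods and asteroids -/

section TripodAsteroid

/-- The distance in the `n`-tripod. -/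
def tripodDist {n : ℕ} : Option (Fin 3 × Fin n) → Option (Fin 3 × Fin n) → ℕ
  | none, none => 0
  | none, some (_, i) => i.val + 1
  | some (_, i), none => i.val + 1
  | some (a, i), some (b, j) =>
    if a = b then (i.val - j.val) + (j.val - i.val) else i.val + j.val + 2

lemma tripod_adj_none {n : ℕ} (a : Fin 3) (i : Fin n) :
    (tripod n).Adj none (some (a, i)) ↔ i.val = 0 := by
  simp [tripod]

lemma tripod_adj_some {n : ℕ} (a b : Fin 3) (i j : Fin n) :
    (tripod n).Adj (some (a, i)) (some (b, j)) ↔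
      a = b ∧ (i.val + 1 = j.val ∨ j.val + 1 = i.val) := by
  simp only [tripod, SimpleGraph.fromRel_adj, ne_eq, Option.some.injEq, Prod.mk.injEq, Fin.ext_iff]
  omega

lemma tripod_dist {n : ℕ} (x y : Option (Fin 3 × Fin n)) :
    (tripod n).Reachable x y ∧ (tripod n).dist x y = tripodDist x y := by
  refine dist_eq_of_descent (tripod n) y (fun x => tripodDist x y) ?_ ?_ ?_ x
  · rcases y with _ | ⟨b, j⟩ <;> simp [tripodDist]
  · have key : ∀ x x', (tripod n).Adj x x' → tripodDist x y ≤ tripodDist x' y + 1 ∧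
        tripodDist x' y ≤ tripodDist x y + 1 := by
      rintro (_ | ⟨a, i⟩) (_ | ⟨a', i'⟩) h
      · exact absurd h ((tripod n).loopless.irrefl _)
      · rw [tripod_adj_none] at h
        rcases y with _ | ⟨b, j⟩ <;> simp only [tripodDist] <;> (try split_ifs) <;> omega
      · replace h := h.symm
        rw [tripod_adj_none] at h
        rcases y with _ | ⟨b, j⟩ <;> simp only [tripodDist] <;> (try split_ifs) <;> omega
      · rw [tripod_adj_some] at h
        obtain ⟨rfl, h⟩ := h
        rcases y with _ | ⟨b, j⟩ <;> simp only [tripodDist] <;> (try split_ifs) <;> omega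
    exact fun x x' h => (key x x' h).1
  · rintro (_ | ⟨a, i⟩) hne
    · rcases y with _ | ⟨b, j⟩
      · exact absurd rfl hne
      · refine ⟨some (b, ⟨0, by have := j.isLt; omega⟩), (tripod_adj_none _ _).2 rfl, ?_⟩
        simp only [tripodDist, if_true]
        omega
    · have hi := i.isLt
      -- move away from the centre exactly if `y` is further out on the same leg
      by_cases hout : ∃ j : Fin n, y = some (a, j) ∧ i.val < j.val
      · obtain ⟨j, rfl, hij⟩ := hout
        have hj := j.isLt
        refine ⟨some (a, ⟨i.val + 1, by omega⟩), (tripod_adj_some _ _ _ _).2 ⟨rfl, Or.inl rfl⟩, ?_⟩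
        simp only [tripodDist, if_true]
        omega
      · by_cases hi0 : i.val = 0
        · refine ⟨none, ((tripod_adj_none _ _).2 hi0).symm, ?_⟩
          rcases y with _ | ⟨b, j⟩
          · simp only [tripodDist]; omega
          · simp only [tripodDist]
            split_ifs with hab
            · subst hab
              by_cases hij : i.val < j.val
              · exact absurd ⟨j, rfl, hij⟩ hout
              · exact absurd (by rw [show i = j from Fin.ext (by omega)]) hne
            · omega
        · refine ⟨some (a, ⟨i.val - 1, by omega⟩), (tripod_adj_some _ _ _ _).2
            ⟨rfl, Or.inr (Nat.succ_pred_eq_of_ne_zero hi0)⟩, ?_⟩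
          rcases y with _ | ⟨b, j⟩
          · simp only [tripodDist]; omega
          · simp only [tripodDist]
            split_ifs with hab
            · subst hab
              by_cases hij : i.val < j.val
              · exact absurd ⟨j, rfl, hij⟩ hout
              · have : i.val ≠ j.val := fun h => hne (by rw [Fin.ext h])
                omega
            · omega

/-- The distance in the `n`-asteroid. -/
def asteroidDist {n : ℕ} (x y : Fin 3 × Fin (n + 1)) : ℕ :=
  if x.1 = y.1 then (x.2.val - y.2.val) + (y.2.val - x.2.val) else x.2.val + y.2.val + 1

lemma asteroid_adj {n : ℕ} (a b : Fin 3) (i j : Fin (n + 1)) :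
    (asteroid n).Adj (a, i) (b, j) ↔ (a = b ∧ (i.val + 1 = j.val ∨ j.val + 1 = i.val)) ∨
      (a ≠ b ∧ i.val = 0 ∧ j.val = 0) := by
  simp only [asteroid, SimpleGraph.fromRel_adj, ne_eq, Prod.mk.injEq, Fin.ext_iff]
  omega

lemma asteroid_dist {n : ℕ} (x y : Fin 3 × Fin (n + 1)) :
    (asteroid n).Reachable x y ∧ (asteroid n).dist x y = asteroidDist x y := by
  obtain ⟨b, j⟩ := y
  refine dist_eq_of_descent (asteroid n) (b, j) (fun x => asteroidDist x (b, j)) ?_ ?_ ?_ x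
  · simp [asteroidDist]
  · rintro ⟨a, i⟩ ⟨a', i'⟩ h
    rw [asteroid_adj] at h
    simp only [asteroidDist]
    split_ifs <;> omega
  · rintro ⟨a, i⟩ hne
    have hi := i.isLt
    have hj := j.isLt
    by_cases hab : a = b
    · subst hab
      have hij : i.val ≠ j.val := fun h => hne (by rw [Fin.ext h])
      rcases lt_or_gt_of_ne hij with h | h
      · refine ⟨(a, ⟨i.val + 1, by omega⟩), (asteroid_adj _ _ _ _).2 (Or.inl ⟨rfl, Or.inl rfl⟩), ?_⟩
        simp only [asteroidDist, if_true]
        omega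
      · refine ⟨(a, ⟨i.val - 1, by omega⟩), (asteroid_adj _ _ _ _).2
          (Or.inl ⟨rfl, Or.inr (show i.val - 1 + 1 = i.val by omega)⟩), ?_⟩
        simp only [asteroidDist, if_true]
        omega
    · by_cases hi0 : i.val = 0
      · refine ⟨(b, ⟨0, by omega⟩), (asteroid_adj _ _ _ _).2 (Or.inr ⟨hab, hi0, rfl⟩), ?_⟩
        simp only [asteroidDist, if_true, if_neg hab]
        omega
      · refine ⟨(a, ⟨i.val - 1, by omega⟩), (asteroid_adj _ _ _ _).2
          (Or.inl ⟨rfl, Or.inr (Nat.succ_pred_eq_of_ne_zero hi0)⟩), ?_⟩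
        simp only [asteroidDist, if_neg hab]
        omega

variable {V : Type*} {G : SimpleGraph V}

lemma containsIsometric_tripod (hG : G.Connected) {m : V} {e : Fin 3 → V} {n : ℕ}
    (hn : ∀ a, n ≤ G.dist m (e a))
    (he : ∀ a b, a ≠ b → G.dist (e a) (e b) = G.dist m (e a) + G.dist m (e b)) :
    ContainsIsometric G (tripod n) := by
  choose g g0 g1 hg using fun a => exists_geodesic hG m (e a)
  have comm := fun a b : V => SimpleGraph.dist_comm (G := G) (u := a) (v := b)
  have hm : ∀ a i, i ≤ n → G.dist m (g a i) = i := fun a i hi => by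
    have := hg a 0 i (by omega) (hi.trans (hn a)); rw [g0] at this; omega
  have hend : ∀ a i, i ≤ n → G.dist (g a i) (e a) = G.dist m (e a) - i := fun a i hi => by
    have := hg a i _ (hi.trans (hn a)) le_rfl; rwa [g1] at this
  have hdiff : ∀ a b i j, a ≠ b → i ≤ n → j ≤ n → G.dist (g a i) (g b j) = i + j := by
    intro a b i j hab hi hj
    have h1 := hm a i hi
    have h2 := hm b j hj
    have h3 := hend a i hi
    have h4 := hend b j hj
    have h5 := he a b hab
    have h6 := hn a
    have h7 := hn b
    have t1 := hG.dist_triangle (u := g a i) (v := m) (w := g b j)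
    have t2 := hG.dist_triangle (u := e a) (v := g a i) (w := e b)
    have t3 := hG.dist_triangle (u := g a i) (v := g b j) (w := e b)
    have c1 := comm m (g a i)
    have c2 := comm (g a i) (e a)
    omega
  have hsame : ∀ a i j, i ≤ n → j ≤ n → G.dist (g a i) (g a j) = (i - j) + (j - i) := by
    intro a i j hi hj
    rcases le_total i j with h | h
    · rw [hg a i j h (hj.trans (hn a))]; omega
    · rw [comm, hg a j i h (hi.trans (hn a))]; omega
  refine ⟨fun x => match x with
    | none => m
    | some (a, i) => g a (i.val + 1), fun x y => ?_⟩
  rw [(tripod_dist x y).2]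
  rcases x with _ | ⟨a, i⟩ <;> rcases y with _ | ⟨b, j⟩ <;> simp only [tripodDist]
  · simp
  · exact hm b _ (by omega)
  · rw [comm]; exact hm a _ (by omega)
  · split_ifs with hab
    · subst hab
      rw [hsame a _ _ (by omega) (by omega)]; omega
    · rw [hdiff a b _ _ hab (by omega) (by omega)]; omega

lemma containsIsometric_asteroid (hG : G.Connected) {c e : Fin 3 → V} {n : ℕ}
    (hc : ∀ a b, a ≠ b → G.dist (c a) (c b) = 1) (hn : ∀ a, n ≤ G.dist (c a) (e a))
    (he : ∀ a b, a ≠ b → G.dist (e a) (e b) = G.dist (c a) (e a) + 1 + G.dist (c b) (e b)) :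
    ContainsIsometric G (asteroid n) := by
  choose g g0 g1 hg using fun a => exists_geodesic hG (c a) (e a)
  have comm := fun a b : V => SimpleGraph.dist_comm (G := G) (u := a) (v := b)
  have hm : ∀ a i, i ≤ n → G.dist (c a) (g a i) = i := fun a i hi => by
    have := hg a 0 i (by omega) (hi.trans (hn a)); rw [g0] at this; omega
  have hend : ∀ a i, i ≤ n → G.dist (g a i) (e a) = G.dist (c a) (e a) - i := fun a i hi => by
    have := hg a i _ (hi.trans (hn a)) le_rfl; rwa [g1] at this
  have hdiff : ∀ a b i j, a ≠ b → i ≤ n → j ≤ n → G.dist (g a i) (g b j) = i + j + 1 := by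
    intro a b i j hab hi hj
    have h0 := hc a b hab
    have h1 := hm a i hi
    have h2 := hm b j hj
    have h3 := hend a i hi
    have h4 := hend b j hj
    have h5 := he a b hab
    have h6 := hn a
    have h7 := hn b
    have t1 := hG.dist_triangle (u := g a i) (v := c a) (w := g b j)
    have t1' := hG.dist_triangle (u := c a) (v := c b) (w := g b j)
    have t2 := hG.dist_triangle (u := e a) (v := g a i) (w := e b)
    have t3 := hG.dist_triangle (u := g a i) (v := g b j) (w := e b)
    have c1 := comm (c a) (g a i)
    have c2 := comm (g a i) (e a)
    omega
  refine ⟨fun x => g x.1 x.2.val, fun x y => ?_⟩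
  rw [(asteroid_dist x y).2]
  obtain ⟨a, i⟩ := x
  obtain ⟨b, j⟩ := y
  simp only [asteroidDist]
  split_ifs with hab
  · subst hab
    rcases le_total i.val j.val with h | h
    · rw [hg a _ _ h (le_trans (by omega) (hn a))]; omega
    · rw [comm, hg a _ _ h (le_trans (by omega) (hn a))]; omega
  · exact hdiff a b _ _ hab (by omega) (by omega)

end TripodAsteroid

/-! ### Branchless levels are quasi-segments -/

section QuasiSegments

variable {V : Type*} {G : SimpleGraph V}

lemma level_connected (hG : IsBridged G) {u v x : V} {k : ℕ} (hx : x ∈ levelSet G u v k) :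
    (level G u v k).Connected :=
  (SimpleGraph.connected_iff _).2 ⟨fun a b => (level_reachable_and_dist hG a b).1, ⟨x, hx⟩⟩

/-- A median vertex is within distance `N` of one of the three vertices. -/
lemma le_of_median (hG : IsBridged G) {u v : V} {k N : ℕ} (hN : IsBranchless (level G u v k) N)
    {x y z m : V} (hx : x ∈ levelSet G u v k) (hy : y ∈ levelSet G u v k)
    (hz : z ∈ levelSet G u v k) (hm : m ∈ levelSet G u v k)
    (hxy : G.dist x m + G.dist m y = G.dist x y) (hxz : G.dist x m + G.dist m z = G.dist x z)
    (hyz : G.dist y m + G.dist m z = G.dist y z) :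
    G.dist x m ≤ N ∨ G.dist m y ≤ N ∨ G.dist m z ≤ N := by
  by_contra! h
  obtain ⟨h1, h2, h3⟩ := h
  have comm := fun a b : V => SimpleGraph.dist_comm (G := G) (u := a) (v := b)
  refine (hN (N + 1) (by omega)).1 (containsIsometric_tripod (level_connected hG hx)
    (m := ⟨m, hm⟩) (e := ![⟨x, hx⟩, ⟨y, hy⟩, ⟨z, hz⟩]) ?_ ?_)
  · intro a
    rw [level_dist hG]
    fin_cases a
    · change _ ≤ G.dist m x; rw [comm]; omega
    · change _ ≤ G.dist m y; omega
    · change _ ≤ G.dist m z; omega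
  · intro a b hab
    simp only [level_dist hG]
    have := comm x m
    have := comm y m
    have := comm x y
    have := comm x z
    have := comm y z
    fin_cases a <;> fin_cases b <;> simp at hab ⊢ <;> omega

/-- A median triangle has a vertex within distance `N` of the corresponding one of the three
vertices. -/
lemma le_of_median_triangle (hG : IsBridged G) {u v : V} {k N : ℕ}
    (hN : IsBranchless (level G u v k) N)
    {x y z a b c : V} (hx : x ∈ levelSet G u v k) (hy : y ∈ levelSet G u v k)
    (hz : z ∈ levelSet G u v k) (ha : a ∈ levelSet G u v k) (hb : b ∈ levelSet G u v k)
    (hc : c ∈ levelSet G u v k) (hab : G.dist a b = 1) (hbc : G.dist b c = 1)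
    (hac : G.dist a c = 1) (hxy : G.dist x a + 1 + G.dist b y = G.dist x y)
    (hxz : G.dist x a + 1 + G.dist c z = G.dist x z)
    (hyz : G.dist y b + 1 + G.dist c z = G.dist y z) :
    G.dist x a ≤ N ∨ G.dist b y ≤ N ∨ G.dist c z ≤ N := by
  by_contra! h
  obtain ⟨h1, h2, h3⟩ := h
  have comm := fun a b : V => SimpleGraph.dist_comm (G := G) (u := a) (v := b)
  have c1 := comm x a
  have c2 := comm y b
  have c3 := comm x y
  have c4 := comm x z
  have c5 := comm y z
  have c6 := comm b a
  have c7 := comm c a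
  have c8 := comm c b
  refine (hN (N + 1) (by omega)).2 (containsIsometric_asteroid (level_connected hG hx)
    (c := ![⟨a, ha⟩, ⟨b, hb⟩, ⟨c, hc⟩]) (e := ![⟨x, hx⟩, ⟨y, hy⟩, ⟨z, hz⟩]) ?_ ?_ ?_)
  · intro i j hij
    simp only [level_dist hG]
    fin_cases i <;> fin_cases j <;> simp [-SimpleGraph.dist_eq_one_iff_adj] at hij ⊢ <;> omega
  · intro i
    rw [level_dist hG]
    fin_cases i
    · change _ ≤ G.dist a x; omega
    · change _ ≤ G.dist b y; omega
    · change _ ≤ G.dist c z; omega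
  · intro i j hij
    simp only [level_dist hG]
    fin_cases i <;> fin_cases j <;> simp at hij ⊢ <;> omega

lemma IsSandwich.dist_le_of_level (hG : IsBridged G) {S T : Set V} (hS : IsSandwich G S T)
    {x y m m' : V} (hx : x ∈ S) (hy : y ∈ S)
    (hm : G.dist x m + G.dist m y = G.dist x y) (hm' : G.dist x m' + G.dist m' y = G.dist x y)
    (hle : G.dist x m ≤ G.dist x m') : G.dist m m' + G.dist x m ≤ G.dist x m' + 1 := by
  obtain ⟨q, h1, h2⟩ := exists_between hG.1 (by omega : G.dist x m' - G.dist x m ≤ G.dist m y)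
  have t1 := hG.1.dist_triangle (u := x) (v := m) (w := q)
  have t2 := hG.1.dist_triangle (u := x) (v := q) (w := y)
  have t3 := hG.1.dist_triangle (u := m) (v := q) (w := m')
  have := hS.interval_clique hG hx hy (p := q) (q := m') (by omega) hm' (by omega)
  omega

/-- The pair `x, y` realises the diameter of the level; its other vertices are projected to the
geodesics between `x` and `y`. The leg of the median of `x, y, z` at `z` is then the shortest one,
so it has length at most `N`. -/
lemma dist_le_of_diametral (hG : IsBridged G) {u v : V} {k N : ℕ} (hk : k + 1 ≤ G.dist u v)
    (hN : IsBranchless (level G u v (k + 1)) N) {x y : V} (hx : x ∈ levelSet G u v (k + 1))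
    (hy : y ∈ levelSet G u v (k + 1))
    (hmax : ∀ a ∈ levelSet G u v (k + 1), ∀ b ∈ levelSet G u v (k + 1),
      G.dist a b ≤ G.dist x y) {z z' : V} (hz : z ∈ levelSet G u v (k + 1))
    (hz' : z' ∈ levelSet G u v (k + 1))
    (hle : (G.dist x z + G.dist x y - G.dist y z) / 2 ≤
      (G.dist x z' + G.dist x y - G.dist y z') / 2) :
    G.dist z z' + (G.dist x z + G.dist x y - G.dist y z) / 2 ≤
      (G.dist x z' + G.dist x y - G.dist y z') / 2 + (2 * N + 2) := by
  have hS := hG.isSandwich_levelSet hk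
  have tri := fun a b c : V => hG.1.dist_triangle (u := a) (v := b) (w := c)
  have comm := fun a b : V => SimpleGraph.dist_comm (G := G) (u := a) (v := b)
  have key : ∀ z ∈ levelSet G u v (k + 1),
      (∃ m, G.dist x m + G.dist m y = G.dist x y ∧
        G.dist x m = (G.dist x z + G.dist x y - G.dist y z) / 2 ∧ G.dist z m ≤ N) ∨
      (∃ a b c, G.dist x a + G.dist a y = G.dist x y ∧ G.dist x b + G.dist b y = G.dist x y ∧
        G.dist x a = (G.dist x z + G.dist x y - G.dist y z) / 2 ∧ G.dist x b = G.dist x a + 1 ∧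
        c ∈ levelSet G u v (k + 1) ∧ G.dist a b = 1 ∧ G.dist b c = 1 ∧ G.dist a c = 1 ∧
        G.dist z c ≤ N ∧ G.dist z a ≤ N + 1 ∧ G.dist z b ≤ N + 1) := by
    intro z hz
    have h1 := hmax x hx z hz
    have h2 := hmax y hy z hz
    rcases hS.exists_median hG hx hy hz with ⟨m, hm, e1, e2, e3⟩ |
      ⟨a, ha, b, hb, c, hc, hab, hbc, hac, e1, e2, e3⟩
    · left
      have := le_of_median hG hN hx hy hz hm e1 e2 e3
      have := comm y m
      have := comm m z
      exact ⟨m, e1, by omega, by omega⟩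
    · right
      have := le_of_median_triangle hG hN hx hy hz ha hb hc hab hbc hac e1 e2 e3
      have := comm y b
      have := comm c z
      have := comm a c
      have := comm b c
      have := tri x a y
      have := tri a b y
      have := tri x a b
      have := tri x b y
      have := tri z c a
      have := tri z c b
      exact ⟨a, b, c, by omega, by omega, by omega, by omega, hc, hab, hbc, hac, by omega, by omega,
        by omega⟩
  rcases key z hz with ⟨m, e1, e2, e3⟩ | ⟨a, b, c, ea, eb, e1, e2, hc, hab, hbc, hac, e3, e4, e5⟩
  · rcases key z' hz' with ⟨m', e1', e2', e3'⟩ |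
      ⟨a', b', c', ea', eb', e1', e2', hc', hab', hbc', hac', e3', e4', e5'⟩
    · have := hS.dist_le_of_level hG hx hy e1 e1' (by omega)
      have := tri z m z'
      have := tri m m' z'
      have := comm m' z'
      omega
    · have := hS.dist_le_of_level hG hx hy e1 ea' (by omega)
      have := tri z m z'
      have := tri m a' z'
      have := comm a' z'
      omega
  · rcases key z' hz' with ⟨m', e1', e2', e3'⟩ |
      ⟨a', b', c', ea', eb', e1', e2', hc', hab', hbc', hac', e3', e4', e5'⟩
    · have := hS.dist_le_of_level hG hx hy ea e1' (by omega)
      have := tri z a z'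
      have := tri a m' z'
      have := comm m' z'
      omega
    · by_cases hlt : G.dist x a < G.dist x a'
      · have := hS.dist_le_of_level hG hx hy eb ea' (by omega)
        have := tri z b z'
        have := tri b a' z'
        have := comm a' z'
        omega
      · have := hS.dist_le_two_of_parallel hG hx hy hc hc' ea eb ea' eb' (by omega) (by omega)
          e2 hab hbc hac hab' hbc' hac'
        have := tri z c z'
        have := tri c c' z'
        have := comm c' z'
        omega

lemma isQuasiSegment_level (hG : IsBridged G) {u v : V} {k N : ℕ} (hk : k ≤ G.dist u v)
    (hN : IsBranchless (level G u v k) N) :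
    IsQuasiSegment (level G u v k) 1 (2 * (N : ℝ) + 2) := by
  have tri := fun a b c : V => hG.1.dist_triangle (u := a) (v := b) (w := c)
  have comm := fun a b : V => SimpleGraph.dist_comm (G := G) (u := a) (v := b)
  -- an integer form of the two inequalities
  have reduce : ∀ (n : ℕ) (f : levelSet G u v k → Fin (n + 1)),
      (∀ y, ∃ x, f x = y) →
      (∀ z z', (f z).val ≤ (f z').val → (f z').val ≤ (f z).val + G.dist z.1 z'.1 ∧
        G.dist z.1 z'.1 + (f z).val ≤ (f z').val + (2 * N + 2)) →
      IsQuasiSegment (level G u v k) 1 (2 * (N : ℝ) + 2) := by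
    intro n f hsurj hf
    refine ⟨n, f, fun y => ?_, fun z z' => ?_⟩
    · obtain ⟨x, hx⟩ := hsurj y
      exact ⟨x, by rw [hx]; simp; positivity⟩
    · rw [inv_one, one_mul, pathGraph_dist, level_dist hG, sub_le_iff_le_add]
      have h : G.dist z.1 z'.1 ≤ ((f z).val - (f z').val) + ((f z').val - (f z).val) + (2 * N + 2) ∧
          ((f z).val - (f z').val) + ((f z').val - (f z).val) ≤ G.dist z.1 z'.1 + (2 * N + 2) := by
        have := comm z.1 z'.1
        rcases le_total (f z).val (f z').val with h | h
        · have := hf z z' h; omega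
        · have := hf z' z h; omega
      exact ⟨by exact_mod_cast h.1, by exact_mod_cast h.2⟩
  obtain ⟨w, hw1, hw2⟩ := exists_between hG.1 hk
  have hw : w ∈ levelSet G u v k := mem_levelSet_iff.2 ⟨hw1, by omega⟩
  rcases k with _ | k
  · refine reduce 0 (fun _ => 0) (fun y => ⟨⟨w, hw⟩, by omega⟩) fun z z' _ => ?_
    have h1 := (mem_levelSet_iff.1 z.2).1
    have h2 := (mem_levelSet_iff.1 z'.2).1
    have := tri z.1 u z'.1
    have := comm z.1 u
    omega
  obtain ⟨x, hx, y, hy, hmax⟩ : ∃ x ∈ levelSet G u v (k + 1), ∃ y ∈ levelSet G u v (k + 1),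
      ∀ a ∈ levelSet G u v (k + 1), ∀ b ∈ levelSet G u v (k + 1), G.dist a b ≤ G.dist x y := by
    set A : Set ℕ := {n | ∃ x ∈ levelSet G u v (k + 1), ∃ y ∈ levelSet G u v (k + 1),
      G.dist x y = n} with hA
    have hbdd : BddAbove A := ⟨2 * (k + 1), by
      rintro n ⟨a, ha, b, hb, rfl⟩
      have := (mem_levelSet_iff.1 ha).1
      have := (mem_levelSet_iff.1 hb).1
      have := tri a u b
      have := comm a u
      omega⟩
    obtain ⟨x, hx, y, hy, hxy⟩ := Nat.sSup_mem (s := A) ⟨_, w, hw, w, hw, rfl⟩ hbdd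
    exact ⟨x, hx, y, hy, fun a ha b hb => hxy ▸ le_csSup hbdd ⟨a, ha, b, hb, rfl⟩⟩
  have hbd : ∀ z ∈ levelSet G u v (k + 1),
      (G.dist x z + G.dist x y - G.dist y z) / 2 < G.dist x y + 1 := by
    intro z hz
    have := tri x y z
    have := hmax x hx z hz
    omega
  refine reduce (G.dist x y)
    (fun z => ⟨(G.dist x z.1 + G.dist x y - G.dist y z.1) / 2, hbd z.1 z.2⟩) ?_ ?_
  · intro i
    obtain ⟨p, h1, h2⟩ := exists_between hG.1 (by omega : i.val ≤ G.dist x y)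
    refine ⟨⟨p, levelSet_convex hG hx hy (by omega)⟩, Fin.ext ?_⟩
    have := comm y p
    simp only
    omega
  · intro z z' hle
    refine ⟨?_, dist_le_of_diametral hG hk hN hx hy hmax z.2 z'.2 hle⟩
    have := tri x z.1 z'.1
    have := tri y z'.1 z.1
    have := comm z.1 z'.1
    have := hmax y hy z.1 z.2
    have := hmax y hy z'.1 z'.2
    simp only
    omega

end QuasiSegments

/-! ### Distances in the triplane -/

section Triplane

/-- The distance in the triplane. A path can change `off` by one with every change of `row`; what
is left of the difference in `off` takes horizontal steps of length two. Between different
half-planes, `off` has to go down to the axis and up again. -/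
def triplaneDist (x y : TriplaneVertex) : ℕ :=
  max (x.row - y.row).natAbs
    (((x.row - y.row).natAbs +
      if x.wing = y.wing then ((x.off : ℤ) - y.off).natAbs else x.off + y.off) / 2)

/-- The vertex with the given coordinates. On the axis the wing is replaced by `0`. -/
def triplaneVertex (r : ℤ) (o : ℕ) (a : Fin 3) (h : Even (r + o)) : TriplaneVertex where
  row := r
  off := o
  wing := if o = 0 then 0 else a
  parity := h
  wing_eq := fun h => if_pos h

/-- The vertices of the triplane in the convex hull of the axis vertices `v_0` and `v_m`. -/
def diamond (m : ℕ) : Set TriplaneVertex :=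
  {x | (x.off : ℤ) ≤ x.row ∧ x.off + x.row ≤ 2 * m}

lemma mem_diamond_iff {m : ℕ} {x : TriplaneVertex} :
    x ∈ diamond m ↔ (x.off : ℤ) ≤ x.row ∧ x.off + x.row ≤ 2 * m :=
  Iff.rfl

lemma TriplaneVertex.exists_two_mul (x : TriplaneVertex) : ∃ k : ℤ, x.row + x.off = 2 * k := by
  obtain ⟨k, hk⟩ := x.parity
  exact ⟨k, by omega⟩

lemma triplane_adj_cases {x x' : TriplaneVertex} (h : triplane.Adj x x') :
    ((x.wing = x'.wing ∨ x.off = 0 ∨ x'.off = 0) ∧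
      (((x.row = x'.row + 1 ∨ x'.row = x.row + 1) ∧ (x.off = x'.off + 1 ∨ x'.off = x.off + 1)) ∨
        (x.row = x'.row ∧ (x.off = x'.off + 2 ∨ x'.off = x.off + 2)))) ∨
    (x.wing ≠ x'.wing ∧ x.row = x'.row ∧ x.off = 1 ∧ x'.off = 1) := by
  rcases h with ⟨h1, h2⟩ | h
  · refine Or.inl ⟨h1, ?_⟩
    rcases h2 with ⟨h3, h4⟩ | ⟨h3, h4⟩
    · rw [abs_eq (by norm_num)] at h3 h4
      exact Or.inl ⟨by omega, by omega⟩
    · rw [abs_eq (by norm_num)] at h4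
      exact Or.inr ⟨h3, by omega⟩
  · exact Or.inr h

lemma triplane_adj_diag {x x' : TriplaneVertex} (hw : x.wing = x'.wing ∨ x.off = 0 ∨ x'.off = 0)
    (hr : x.row = x'.row + 1 ∨ x'.row = x.row + 1) (ho : x.off = x'.off + 1 ∨ x'.off = x.off + 1) :
    triplane.Adj x x' := by
  refine Or.inl ⟨hw, Or.inl ⟨?_, ?_⟩⟩ <;> rw [abs_eq (by norm_num)] <;> omega

lemma triplane_adj_horizontal {x x' : TriplaneVertex}
    (hw : x.wing = x'.wing ∨ x.off = 0 ∨ x'.off = 0)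
    (hr : x.row = x'.row) (ho : x.off = x'.off + 2 ∨ x'.off = x.off + 2) :
    triplane.Adj x x' := by
  refine Or.inl ⟨hw, Or.inr ⟨hr, ?_⟩⟩
  rw [abs_eq (by norm_num)]
  omega

lemma triplaneDist_lipschitz {x x' : TriplaneVertex} (y : TriplaneVertex)
    (h : triplane.Adj x x') : triplaneDist x y ≤ triplaneDist x' y + 1 := by
  have hx := x.wing_eq
  have hx' := x'.wing_eq
  have hy := y.wing_eq
  unfold triplaneDist
  rcases triplane_adj_cases h with ⟨hw | hw | hw, h⟩ | ⟨hw, h⟩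
  · rw [hw]
    split_ifs <;> omega
  · have : x.wing = 0 := hx hw
    split_ifs <;> omega
  · have : x'.wing = 0 := hx' hw
    split_ifs <;> omega
  · split_ifs <;> omega

lemma exists_triplane_step {x y : TriplaneVertex} (hxy : x ≠ y) :
    ∃ x', triplane.Adj x x' ∧ triplaneDist x' y + 1 ≤ triplaneDist x y ∧
      ∀ m, x ∈ diamond m → y ∈ diamond m → x' ∈ diamond m := by
  obtain ⟨k, hk⟩ := x.exists_two_mul
  obtain ⟨l, hl⟩ := y.exists_two_mul
  have hx := x.wing_eq
  have hy := y.wing_eq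
  have hne : x.row = y.row → x.off = y.off → x.wing ≠ y.wing := fun h1 h2 h3 =>
    hxy (TriplaneVertex.ext h1 h2 h3)
  have par : ∀ (r : ℤ) (o : ℕ), (∃ k : ℤ, r + o = 2 * k) → Even (r + o) :=
    fun r o ⟨k, hk⟩ => ⟨k, by omega⟩
  by_cases hrow : x.row = y.row
  · by_cases hout : x.off = 0 ∨ (x.wing = y.wing ∧ x.off < y.off)
    · -- step outwards, in the half-plane of `y`
      have hy0 : y.off ≠ 0 := by
        intro h
        rcases hout with h' | h'
        · exact hne hrow (by omega) (by rw [hx h', hy h])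
        · omega
      refine ⟨triplaneVertex x.row (x.off + 2) y.wing (par _ _ ⟨k + 1, by push_cast; omega⟩),
        triplane_adj_horizontal ?_ rfl (Or.inr rfl), ?_, ?_⟩
      · rcases hout with h | h
        · exact Or.inr (Or.inl h)
        · left; simp [triplaneVertex, h.1]
      · simp only [triplaneDist, triplaneVertex, Nat.add_eq_zero_iff, OfNat.ofNat_ne_zero, and_false,
          if_false, if_true]
        split_ifs <;> omega
      · intro m h1 h2
        simp only [mem_diamond_iff, triplaneVertex] at *
        push_cast
        omega
    · by_cases hone : x.off = 1 ∧ x.wing ≠ y.wing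
      · -- step across the triangle at the axis
        refine ⟨triplaneVertex x.row 1 y.wing (par _ _ ⟨k, by push_cast; omega⟩),
          Or.inr ⟨?_, rfl, hone.1, rfl⟩, ?_, ?_⟩
        · simpa [triplaneVertex] using hone.2
        · simp only [triplaneDist, triplaneVertex, one_ne_zero, if_false, if_true, if_neg hone.2]
          omega
        · intro m h1 h2
          simp only [mem_diamond_iff, triplaneVertex] at *
          push_cast
          omega
      · have hge : 2 ≤ x.off := by
          by_contra h
          by_cases hw : x.wing = y.wing
          · have := hne hrow
            omega
          · omega
        refine ⟨triplaneVertex x.row (x.off - 2) x.wing (par _ _ ⟨k - 1, by omega⟩),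
          triplane_adj_horizontal ?_ rfl (Or.inl (by simp only [triplaneVertex]; omega)), ?_, ?_⟩
        · by_cases h : x.off - 2 = 0
          · exact Or.inr (Or.inr h)
          · left; simp [triplaneVertex, h]
        · simp only [triplaneDist, triplaneVertex]
          have := hne hrow
          split_ifs <;> omega
        · intro m h1 h2
          simp only [mem_diamond_iff, triplaneVertex] at *
          omega
  · obtain ⟨r, hr, hr'⟩ : ∃ r : ℤ, (x.row = r + 1 ∨ r = x.row + 1) ∧
        (r - y.row).natAbs + 1 = (x.row - y.row).natAbs := by
      rcases lt_or_gt_of_ne hrow with h | h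
      · exact ⟨x.row + 1, Or.inr rfl, by omega⟩
      · exact ⟨x.row - 1, Or.inl (by omega), by omega⟩
    obtain ⟨k', hk'⟩ : ∃ k' : ℤ, r + x.off + 1 = 2 * k' := by
      rcases hr with h | h
      · exact ⟨k, by omega⟩
      · exact ⟨k + 1, by omega⟩
    by_cases hout : x.off = 0 ∨ (x.wing = y.wing ∧ x.off < y.off)
    · refine ⟨triplaneVertex r (x.off + 1) y.wing (par _ _ ⟨k', by push_cast; omega⟩),
        triplane_adj_diag ?_ hr (Or.inr rfl), ?_, ?_⟩
      · rcases hout with h | h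
        · exact Or.inr (Or.inl h)
        · left; simp [triplaneVertex, h.1]
      · simp only [triplaneDist, triplaneVertex, Nat.add_eq_zero_iff, one_ne_zero, and_false,
          if_false, if_true]
        split_ifs <;> omega
      · intro m h1 h2
        simp only [mem_diamond_iff, triplaneVertex] at *
        push_cast
        omega
    · have hge : 1 ≤ x.off := by omega
      refine ⟨triplaneVertex r (x.off - 1) x.wing (par _ _ ⟨k' - 1, by omega⟩),
        triplane_adj_diag ?_ hr (Or.inl (by simp only [triplaneVertex]; omega)), ?_, ?_⟩
      · by_cases h : x.off - 1 = 0
        · exact Or.inr (Or.inr h)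
        · left; simp [triplaneVertex, h]
      · simp only [triplaneDist, triplaneVertex]
        split_ifs <;> omega
      · intro m h1 h2
        simp only [mem_diamond_iff, triplaneVertex] at *
        omega

lemma triplaneDist_self (x : TriplaneVertex) : triplaneDist x x = 0 := by
  simp [triplaneDist]

lemma triplane_dist (x y : TriplaneVertex) : triplane.dist x y = triplaneDist x y :=
  (dist_eq_of_descent triplane y (fun x => triplaneDist x y) (triplaneDist_self y)
    (fun _ _ h => triplaneDist_lipschitz y h)
    (fun _ hxy => let ⟨x', h1, h2, _⟩ := exists_triplane_step hxy; ⟨x', h1, h2⟩) x).2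

lemma triplaneDist_axisVertex_left (i : ℤ) (x : TriplaneVertex) :
    triplaneDist (axisVertex i) x =
      max (2 * i - x.row).natAbs (((2 * i - x.row).natAbs + x.off) / 2) := by
  simp only [triplaneDist, axisVertex]
  split_ifs <;> simp

lemma triplaneDist_axisVertex_right (i : ℤ) (x : TriplaneVertex) :
    triplaneDist x (axisVertex i) =
      max (x.row - 2 * i).natAbs (((x.row - 2 * i).natAbs + x.off) / 2) := by
  simp only [triplaneDist, axisVertex]
  split_ifs <;> simp

lemma mem_interval_axis_iff {m : ℕ} {x : TriplaneVertex} :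
    x ∈ interval triplane (axisVertex 0) (axisVertex (m : ℤ)) ↔ x ∈ diamond m := by
  obtain ⟨k, hk⟩ := x.exists_two_mul
  have e : triplaneDist (axisVertex 0) (axisVertex (m : ℤ)) = 2 * m := by
    rw [triplaneDist_axisVertex_left]
    simp only [axisVertex]
    omega
  change triplane.dist _ _ + triplane.dist _ _ = triplane.dist _ _ ↔ _
  rw [triplane_dist, triplane_dist, triplane_dist, e, triplaneDist_axisVertex_left,
    triplaneDist_axisVertex_right, mem_diamond_iff]
  omega

lemma arrowhead_dist {m : ℕ}
    (x y : interval triplane (axisVertex 0) (axisVertex (m : ℤ))) :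
    (arrowhead m).Reachable x y ∧ (arrowhead m).dist x y = triplaneDist x.1 y.1 := by
  refine dist_eq_of_descent (arrowhead m) y (fun x => triplaneDist x.1 y.1) (triplaneDist_self y.1)
    (fun _ _ h => triplaneDist_lipschitz y.1 h) (fun x hxy => ?_) x
  obtain ⟨x', h1, h2, h3⟩ := exists_triplane_step (x := x.1) (y := y.1) (fun h => hxy (Subtype.ext h))
  exact ⟨⟨x', mem_interval_axis_iff.2
    (h3 m (mem_interval_axis_iff.1 x.2) (mem_interval_axis_iff.1 y.2))⟩, h1, h2⟩

/-! ### Arrowheads obstruct fitness -/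

variable {V : Type*} {G : SimpleGraph V}

/-- An isometric copy in the set `S` of the part of a tripod within distance `n` of its centre;
`τ a i` is the vertex of the leg `a` at distance `i` from the centre `τ a 0`. -/
structure IsTripodIn (G : SimpleGraph V) (S : Set V) (n : ℕ) (τ : Fin 3 → ℕ → V) : Prop where
  mem : ∀ a i, i ≤ n → τ a i ∈ S
  same : ∀ a i j, i ≤ n → j ≤ n → G.dist (τ a i) (τ a j) = (i - j) + (j - i)
  diff : ∀ a b i j, a ≠ b → i ≤ n → j ≤ n → G.dist (τ a i) (τ b j) = i + j

/-- A row of an arrowhead near the middle contains a tripod, which lies in a level of the ambient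
graph. -/
lemma exists_isTripodIn_of_arrowhead {n m : ℕ} (hn : 2 * n ≤ m)
    (h : ContainsIsometric G (arrowhead m)) :
    ∃ (u v : V) (k : ℕ) (τ : Fin 3 → ℕ → V), k ≤ G.dist u v ∧
      IsTripodIn G (levelSet G u v k) n τ := by
  obtain ⟨f, hf⟩ := h
  let p : Fin 3 → ℕ → TriplaneVertex := fun a i =>
    triplaneVertex (2 * n) (2 * min i n) a ⟨n + min i n, by push_cast; omega⟩
  have hp : ∀ a i, p a i ∈ interval triplane (axisVertex 0) (axisVertex (m : ℤ)) := by
    intro a i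
    rw [mem_interval_axis_iff, mem_diamond_iff]
    simp only [p, triplaneVertex]
    push_cast
    omega
  have h0 : axisVertex 0 ∈ interval triplane (axisVertex 0) (axisVertex (m : ℤ)) := by
    rw [mem_interval_axis_iff, mem_diamond_iff]
    simp only [axisVertex]
    omega
  have hm : axisVertex m ∈ interval triplane (axisVertex 0) (axisVertex (m : ℤ)) := by
    rw [mem_interval_axis_iff, mem_diamond_iff]
    simp only [axisVertex]
    omega
  have hdist : ∀ x y (hx : x ∈ interval triplane (axisVertex 0) (axisVertex (m : ℤ)))
      (hy : y ∈ interval triplane (axisVertex 0) (axisVertex (m : ℤ))),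
      G.dist (f ⟨x, hx⟩) (f ⟨y, hy⟩) = triplaneDist x y := fun x y hx hy => by
    rw [hf, (arrowhead_dist _ _).2]
  refine ⟨f ⟨_, h0⟩, f ⟨_, hm⟩, 2 * n, fun a i => f ⟨p a i, hp a i⟩, ?_, ?_, ?_, ?_⟩
  · rw [hdist]
    simp only [triplaneDist, axisVertex, if_true]
    omega
  · intro a i hi
    rw [mem_levelSet_iff, hdist, hdist, hdist]
    simp only [triplaneDist, axisVertex, p, triplaneVertex, if_true]
    constructor
    · split_ifs <;> omega
    · split_ifs <;> omega
  · intro a i j hi hj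
    rw [hdist]
    simp only [triplaneDist, p, triplaneVertex]
    split_ifs <;> omega
  · intro a b i j hab hi hj
    rw [hdist]
    simp only [triplaneDist, p, triplaneVertex]
    split_ifs <;> omega

lemma exists_abs_sub_le_of_steps {g : ℕ → ℝ} {s c : ℝ} (hs : 0 ≤ s) {T : ℕ}
    (hg : ∀ t < T, |g (t + 1) - g t| ≤ s) (h0 : g 0 ≤ c) (hT : c ≤ g T) :
    ∃ t ≤ T, |g t - c| ≤ s := by
  classical
  have hex : ∃ t, c ≤ g t := ⟨T, hT⟩
  have h1 := Nat.find_spec hex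
  have h2 : Nat.find hex ≤ T := Nat.find_min' hex hT
  refine ⟨Nat.find hex, h2, ?_⟩
  rcases hn : Nat.find hex with _ | n
  · rw [hn] at h1
    rw [abs_le]
    constructor <;> linarith
  · have h3 : g n < c := not_le.1 (Nat.find_min hex (by omega))
    have h4 := abs_le.1 (hg n (by omega))
    rw [hn] at h1
    rw [abs_le]
    constructor <;> linarith

/-- A tripod in a quasi-segment has bounded size: of the images of its three ends in the segment
one is between the other two, hence close to the image of a point on the path joining these. -/
lemma le_of_tripod_of_isQuasiSegment {B C : ℝ} (hB : 0 < B) (hC : 0 < C)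
    (hseg : IsQuasiSegment G B C) {S : Set V} {n : ℕ} {τ : Fin 3 → ℕ → V}
    (hτ : IsTripodIn G S n τ) : (n : ℝ) ≤ B * (B + 2 * C) := by
  obtain ⟨-, hsame, hdiff⟩ := hτ
  rcases Nat.eq_zero_or_pos n with rfl | hn
  · simp only [Nat.cast_zero]
    positivity
  obtain ⟨N, f, -, hf⟩ := hseg
  set h : V → ℝ := fun x => ((f x).val : ℝ) with hh
  have hf' : ∀ x y, B⁻¹ * (G.dist x y : ℝ) - C ≤ |h x - h y| ∧ |h x - h y| ≤
      B * (G.dist x y : ℝ) + C := by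
    intro x y
    have : ((SimpleGraph.pathGraph (N + 1)).dist (f x) (f y) : ℝ) = |h x - h y| := by
      rw [pathGraph_dist]
      rcases le_total (f x).val (f y).val with hle | hle
      · rw [abs_of_nonpos (by simp only [hh]; exact sub_nonpos.2 (by exact_mod_cast hle)),
          Nat.sub_eq_zero_of_le hle, zero_add, Nat.cast_sub hle]
        simp [hh]
      · rw [abs_of_nonneg (by simp only [hh]; exact sub_nonneg.2 (by exact_mod_cast hle)),
          Nat.sub_eq_zero_of_le hle, add_zero, Nat.cast_sub hle]
    rw [← this]
    exact hf x y
  obtain ⟨a, b, c, hab, hbc, hac, h1, h2⟩ : ∃ a b c : Fin 3, a ≠ b ∧ b ≠ c ∧ a ≠ c ∧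
      h (τ a n) ≤ h (τ b n) ∧ h (τ b n) ≤ h (τ c n) := by
    rcases le_total (h (τ 0 n)) (h (τ 1 n)) with h1 | h1 <;>
    rcases le_total (h (τ 1 n)) (h (τ 2 n)) with h2 | h2 <;>
    rcases le_total (h (τ 0 n)) (h (τ 2 n)) with h3 | h3
    · exact ⟨0, 1, 2, by decide, by decide, by decide, h1, h2⟩
    · exact ⟨0, 1, 2, by decide, by decide, by decide, h1, h2⟩
    · exact ⟨0, 2, 1, by decide, by decide, by decide, h3, h2⟩
    · exact ⟨2, 0, 1, by decide, by decide, by decide, h3, h1⟩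
    · exact ⟨1, 0, 2, by decide, by decide, by decide, h1, h3⟩
    · exact ⟨1, 2, 0, by decide, by decide, by decide, h2, h3⟩
    · exact ⟨2, 1, 0, by decide, by decide, by decide, h2, h1⟩
    · exact ⟨2, 1, 0, by decide, by decide, by decide, h2, h1⟩
  obtain ⟨t, ht, hbt⟩ := exists_abs_sub_le_of_steps (T := 2 * n) (s := B + C) (c := h (τ b n))
    (g := fun t => h (if t ≤ n then τ a (n - t) else τ c (t - n))) (by positivity) (by
      intro t ht
      have hone : G.dist (if t + 1 ≤ n then τ a (n - (t + 1)) else τ c (t + 1 - n))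
          (if t ≤ n then τ a (n - t) else τ c (t - n)) = 1 := by
        split_ifs
        · rw [hsame _ _ _ (by omega) (by omega)]; omega
        · omega
        · rw [hdiff _ _ _ _ hac.symm (by omega) (by omega)]; omega
        · rw [hsame _ _ _ (by omega) (by omega)]; omega
      have := (hf' (if t + 1 ≤ n then τ a (n - (t + 1)) else τ c (t + 1 - n))
        (if t ≤ n then τ a (n - t) else τ c (t - n))).2
      rw [hone] at this
      simpa using this) (by simpa using h1) (by
      simp only [show ¬ (2 * n ≤ n) by omega, if_false]
      rwa [show 2 * n - n = n by omega])
  have hfar : n ≤ G.dist (if t ≤ n then τ a (n - t) else τ c (t - n)) (τ b n) := by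
    split_ifs
    · rw [hdiff _ _ _ _ hab (by omega) (by omega)]; omega
    · rw [hdiff _ _ _ _ hbc.symm (by omega) (by omega)]; omega
  have h3 := (hf' (if t ≤ n then τ a (n - t) else τ c (t - n)) (τ b n)).1
  have h4 : (n : ℝ) ≤ G.dist (if t ≤ n then τ a (n - t) else τ c (t - n)) (τ b n) := by
    exact_mod_cast hfar
  have h5 : B⁻¹ * (n : ℝ) ≤ B + 2 * C := by
    have := mul_le_mul_of_nonneg_left h4 (inv_pos.2 hB).le
    linarith
  calc (n : ℝ) = B * (B⁻¹ * n) := by rw [← mul_assoc, mul_inv_cancel₀ hB.ne', one_mul]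
    _ ≤ B * (B + 2 * C) := mul_le_mul_of_nonneg_left h5 hB.le

lemma exists_isHarmless_of_quasiSegments (hG : IsBridged G) {B C : ℝ} (hB : 0 < B) (hC : 0 < C)
    (h : ∀ (u v : V) (k : ℕ), k ≤ G.dist u v → IsQuasiSegment (level G u v k) B C) :
    ∃ M, IsHarmless G M := by
  obtain ⟨n, hn⟩ := exists_nat_gt (B * (B + 2 * C))
  refine ⟨2 * n, fun m hm hcon => ?_⟩
  obtain ⟨u, v, k, τ, hk, hmem, hsame, hdiff⟩ := exists_isTripodIn_of_arrowhead (n := n) (by omega) hcon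
  have : IsTripodIn (level G u v k) Set.univ n
      (fun a i => ⟨τ a (min i n), hmem a _ (by omega)⟩) := by
    refine ⟨fun _ _ _ => Set.mem_univ _, fun a i j hi hj => ?_, fun a b i j hab hi hj => ?_⟩
    · rw [level_dist hG]
      simp only [min_eq_left hi, min_eq_left hj]
      exact hsame a i j hi hj
    · rw [level_dist hG]
      simp only [min_eq_left hi, min_eq_left hj]
      exact hdiff a b i j hab hi hj
  have := le_of_tripod_of_isQuasiSegment hB hC (h u v k hk) this
  linarith

end Triplane

/-! ### Geodesics between different levels -/

section Heights

variable {V : Type*} {G : SimpleGraph V}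

/-- A geodesic from `x` to a vertex nearer to `u` can be chosen to start with a step towards
`u`. -/
lemma IsBridged.exists_descending_step (hG : IsBridged G) {u x y : V}
    (hlt : G.dist u y < G.dist u x) :
    ∃ x', G.dist x x' = 1 ∧ G.dist u x' + 1 = G.dist u x ∧ G.dist x' y + 1 = G.dist x y := by
  have tri := fun a b c : V => hG.1.dist_triangle (u := a) (v := b) (w := c)
  have comm := fun a b : V => SimpleGraph.dist_comm (G := G) (u := a) (v := b)
  induction hD : G.dist x y using Nat.strong_induction_on generalizing x with
  | _ D ih =>
    have hpos : 1 ≤ G.dist x y := by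
      have := tri u y x
      have := comm y x
      omega
    obtain ⟨g, h1, h2⟩ := exists_between hG.1 hpos
    have hle := hG.dist_le_max (u := u) (a := x) (b := y) (c := g) (r := G.dist u x) (by omega)
      le_rfl hlt.le
    have t1 := tri u g x
    have c1 := comm g x
    by_cases hg : G.dist u g + 1 = G.dist u x
    · exact ⟨g, h1, hg, by omega⟩
    · obtain ⟨g', e1, e2, e3⟩ := ih (G.dist g y) (by omega) (x := g) (by omega) rfl
      obtain ⟨w, hwx, hwg, hw⟩ := hG.exists_below (u := u) (x := x) (y := g) (by omega) (by omega) h1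
      have c2 := comm g w
      have c3 := comm x w
      have := hG.dist_below_le_one (u := u) (x := g) (y := w) (z := g') (by omega) e1 (by omega) e2
      have t2 := tri w g' y
      have t3 := tri x w y
      exact ⟨w, by omega, by omega, by omega⟩

variable {u v : V}

lemma mem_levelSet_of_between (hG : G.Connected) {p q w : V} {s i j : ℕ}
    (hp : p ∈ levelSet G u v s) (hq : q ∈ levelSet G u v (s + i + j)) (h1 : G.dist p w ≤ i)
    (h2 : G.dist w q ≤ j) : w ∈ levelSet G u v (s + i) := by
  rw [mem_levelSet_iff] at *
  have := hG.dist_triangle (u := u) (v := p) (w := w)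
  have := hG.dist_triangle (u := u) (v := w) (w := q)
  have := hG.dist_triangle (u := w) (v := q) (w := v)
  have := hG.dist_triangle (u := u) (v := w) (w := v)
  omega

lemma le_of_mem_levelSet {x : V} {k : ℕ} (hx : x ∈ levelSet G u v k) : k ≤ G.dist u v := by
  have := (mem_levelSet_iff.1 hx).2
  omega

lemma IsBridged.exists_descent (hG : IsBridged G) {x y : V} {s t : ℕ}
    (hx : x ∈ levelSet G u v (s + t)) (hy : y ∈ levelSet G u v s) :
    ∃ x' ∈ levelSet G u v s, G.dist x x' = t ∧ t + G.dist x' y = G.dist x y := by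
  induction t generalizing x with
  | zero => exact ⟨x, hx, by simp, by simp⟩
  | succ t ih =>
    have h1 := (mem_levelSet_iff.1 hx).1
    have h2 := (mem_levelSet_iff.1 hy).1
    obtain ⟨w, e1, e2, e3⟩ := hG.exists_descending_step (u := u) (x := x) (y := y) (by omega)
    have hw : w ∈ levelSet G u v (s + t) :=
      mem_levelSet_of_below hG.1 hx (by rw [SimpleGraph.dist_comm]; omega) (by omega)
    obtain ⟨x', hx', e4, e5⟩ := ih hw
    have t1 := hG.1.dist_triangle (u := x) (v := w) (w := x')
    have t2 := hG.1.dist_triangle (u := x) (v := x') (w := y)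
    exact ⟨x', hx', by omega, by omega⟩

lemma IsBridged.dist_le_add_one_of_above (hG : IsBridged G) {p q p' q' : V} {s : ℕ}
    (hp : p ∈ levelSet G u v s) (hq : q ∈ levelSet G u v s) (hp' : p' ∈ levelSet G u v (s + 1))
    (hq' : q' ∈ levelSet G u v (s + 1)) (hpp : G.dist p p' ≤ 1) (hqq : G.dist q q' ≤ 1) :
    G.dist p' q' ≤ G.dist p q + 1 := by
  have hS := hG.isSandwich_levelSet (le_of_mem_levelSet hp')
  induction hd : G.dist p q generalizing p p' with
  | zero =>
    obtain rfl := hG.1.dist_eq_zero_iff.1 hd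
    exact hS.up_clique hp hp' hq' hpp hqq
  | succ d ih =>
    obtain ⟨r, h1, h2⟩ := exists_between hG.1 (by omega : 1 ≤ G.dist p q)
    have hr := levelSet_convex hG hp hq (c := r) (by omega)
    obtain ⟨e, he, hpe, hre⟩ := hS.up_two hp hr (by omega)
    have h3 := ih hr he (by omega) (by omega)
    have h4 := hS.up_clique hp hp' he (by omega) (by omega)
    have := hG.1.dist_triangle (u := p') (v := e) (w := q')
    omega

lemma IsBridged.dist_le_add_of_above (hG : IsBridged G) {p q p' q' : V} {s j : ℕ}
    (hp : p ∈ levelSet G u v s) (hq : q ∈ levelSet G u v s) (hp' : p' ∈ levelSet G u v (s + j))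
    (hq' : q' ∈ levelSet G u v (s + j)) (hpp : G.dist p p' ≤ j) (hqq : G.dist q q' ≤ j) :
    G.dist p' q' ≤ G.dist p q + j := by
  have one : ∀ {j : ℕ} {s : ℕ} {p p' : V}, p ∈ levelSet G u v s →
      p' ∈ levelSet G u v (s + (j + 1)) → G.dist p p' ≤ j + 1 →
      ∃ r ∈ levelSet G u v (s + 1), G.dist p r ≤ 1 ∧ G.dist r p' ≤ j := by
    intro j s p p' hp hp' hpp
    have h1 := (mem_levelSet_iff.1 hp).1
    have h2 := (mem_levelSet_iff.1 hp').1
    have := hG.1.dist_triangle (u := u) (v := p) (w := p')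
    obtain ⟨r, e1, e2⟩ := exists_between hG.1 (by omega : 1 ≤ G.dist p p')
    exact ⟨r, mem_levelSet_of_between hG.1 hp (i := 1) (j := j)
      (by rwa [show s + 1 + j = s + (j + 1) by omega]) (by omega) (by omega), by omega, by omega⟩
  induction j generalizing s p q with
  | zero =>
    obtain rfl := hG.1.dist_eq_zero_iff.1 (by omega : G.dist p p' = 0)
    obtain rfl := hG.1.dist_eq_zero_iff.1 (by omega : G.dist q q' = 0)
    rfl
  | succ j ih =>
    obtain ⟨r, hr, e1, e2⟩ := one hp hp' hpp
    obtain ⟨r', hr', e3, e4⟩ := one hq hq' hqq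
    have h1 := hG.dist_le_add_one_of_above hp hq hr hr' e1 e3
    have h2 := ih hr hr' (by rwa [show s + 1 + j = s + (j + 1) by omega])
      (by rwa [show s + 1 + j = s + (j + 1) by omega]) e2 e4
    omega

/-- Lifting the lower one of two vertices to the level of the upper one does not increase their
distance. -/
lemma IsBridged.dist_le_of_above (hG : IsBridged G) {x y y' : V} {s t : ℕ}
    (hx : x ∈ levelSet G u v (s + t)) (hy : y ∈ levelSet G u v s)
    (hy' : y' ∈ levelSet G u v (s + t)) (hyy : G.dist y y' ≤ t) : G.dist x y' ≤ G.dist x y := by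
  obtain ⟨x', hx', e1, e2⟩ := hG.exists_descent hx hy
  have := hG.dist_le_add_of_above hx' hy hx hy' (by rw [SimpleGraph.dist_comm]; omega) hyy
  omega

/-- Lifting two vertices to a common level increases their distance at most by the height of that
level over the upper one. -/
lemma IsBridged.dist_le_add_of_above_above (hG : IsBridged G) {x y x' y' : V} {s t j : ℕ}
    (hx : x ∈ levelSet G u v (s + t)) (hy : y ∈ levelSet G u v s)
    (hx' : x' ∈ levelSet G u v (s + t + j)) (hy' : y' ∈ levelSet G u v (s + t + j))
    (hxx : G.dist x x' ≤ j) (hyy : G.dist y y' ≤ t + j) : G.dist x' y' ≤ G.dist x y + j := by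
  have h1 := (mem_levelSet_iff.1 hy).1
  have h2 := (mem_levelSet_iff.1 hy').1
  have := hG.1.dist_triangle (u := u) (v := y) (w := y')
  obtain ⟨w, e1, e2⟩ := exists_between hG.1 (by omega : t ≤ G.dist y y')
  have hw := mem_levelSet_of_between hG.1 hy hy' e1.le (by omega)
  have h3 := hG.dist_le_of_above hx hy hw e1.le
  have h4 := hG.dist_le_add_of_above hx hw hx' hy' hxx (by omega)
  omega

/-- Moving two vertices on different sides of a level to that level does not increase their
distance. -/
lemma IsBridged.dist_le_of_below_above (hG : IsBridged G) {x y x' y' : V} {s t j : ℕ}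
    (hx : x ∈ levelSet G u v (s + t + j)) (hy : y ∈ levelSet G u v s)
    (hx' : x' ∈ levelSet G u v (s + t)) (hy' : y' ∈ levelSet G u v (s + t))
    (hxx : G.dist x x' ≤ j) (hyy : G.dist y y' ≤ t) : G.dist x' y' ≤ G.dist x y := by
  have comm := fun a b : V => SimpleGraph.dist_comm (G := G) (u := a) (v := b)
  obtain ⟨z, hz, e1, e2⟩ := hG.exists_descent (s := s) (t := t + j) (by rwa [← add_assoc]) hy
  obtain ⟨w, e3, e4⟩ := exists_between hG.1 (by omega : j ≤ G.dist x z)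
  have hw := mem_levelSet_of_between hG.1 hz hx (w := w) (i := t) (j := j) (by rw [comm]; omega)
    (by rw [comm]; omega)
  have t1 := hG.1.dist_triangle (u := w) (v := z) (w := y)
  have h1 := hG.dist_le_of_above hw hy hy' hyy
  -- `x'` and `w` both lie below `x`
  obtain ⟨l, hl⟩ := Nat.exists_eq_add_of_le (le_of_mem_levelSet hx)
  have h2 := hG.dist_le_add_of_above (u := v) (v := u) (s := l) (j := j) (p := x) (q := x)
    (mem_levelSet_swap (by omega) hx) (mem_levelSet_swap (by omega) hx)
    (mem_levelSet_swap (l := l + j) (by omega) hx') (mem_levelSet_swap (l := l + j) (by omega) hw)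
    hxx e3.le
  have h3 : G.dist x x = 0 := SimpleGraph.dist_self
  have t2 := hG.1.dist_triangle (u := x') (v := w) (w := y')
  omega

end Heights

/-! ### Arrowheads from tripods and asteroids -/

section Arrowheads

variable {V : Type*} {G : SimpleGraph V}

lemma exists_isTripodIn_of_tripod (hG : IsBridged G) {u v : V} {k n : ℕ}
    (h : ContainsIsometric (level G u v k) (tripod n)) :
    ∃ τ, IsTripodIn G (levelSet G u v k) n τ := by
  obtain ⟨f, hf⟩ := h
  have hf' : ∀ x y, G.dist (f x).1 (f y).1 = tripodDist x y := fun x y => by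
    rw [← level_dist hG, hf, (tripod_dist x y).2]
  refine ⟨fun a i => if h : 0 < i ∧ i ≤ n then (f (some (a, ⟨i - 1, by omega⟩))).1 else (f none).1,
    ?_, ?_, ?_⟩
  · intro a i _
    split_ifs
    · exact (f _).2
    · exact (f _).2
  · intro a i j hi hj
    split_ifs <;> rw [hf'] <;> simp only [tripodDist, if_true] <;> omega
  · intro a b i j hab hi hj
    split_ifs <;> rw [hf'] <;> simp only [tripodDist, if_neg hab] <;> omega

/-- The lower neighbours of the edges and of the central triangle of an asteroid form a tripod. -/
lemma exists_isTripodIn_of_asteroid (hG : IsBridged G) {u v : V} {k n : ℕ} (hn : 1 ≤ n)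
    (h : ContainsIsometric (level G u v k) (asteroid n)) :
    ∃ l τ, IsTripodIn G (levelSet G u v l) n τ := by
  have tri := fun a b c : V => hG.1.dist_triangle (u := a) (v := b) (w := c)
  have comm := fun a b : V => SimpleGraph.dist_comm (G := G) (u := a) (v := b)
  obtain ⟨f, hf⟩ := h
  obtain ⟨σ, hmem, hsame, hdiff⟩ : ∃ σ : Fin 3 → ℕ → V, (∀ a i, σ a i ∈ levelSet G u v k) ∧
      (∀ a i j, i ≤ n → j ≤ n → G.dist (σ a i) (σ a j) = (i - j) + (j - i)) ∧
      (∀ a b i j, a ≠ b → i ≤ n → j ≤ n → G.dist (σ a i) (σ b j) = i + j + 1) := by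
    refine ⟨fun a i => (f (a, ⟨min i n, by omega⟩)).1, fun a i => (f _).2, ?_, ?_⟩
    · intro a i j hi hj
      rw [← level_dist hG, hf, (asteroid_dist _ _).2]
      simp only [asteroidDist, if_true]
      omega
    · intro a b i j hab hi hj
      rw [← level_dist hG, hf, (asteroid_dist _ _).2]
      simp only [asteroidDist, if_neg hab]
      omega
  have h01 : (0 : Fin 3) ≠ 1 := by decide
  have h12 : (1 : Fin 3) ≠ 2 := by decide
  have h02 : (0 : Fin 3) ≠ 2 := by decide
  rcases k with _ | k
  · have h1 := (mem_levelSet_iff.1 (hmem 0 0)).1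
    have h2 := (mem_levelSet_iff.1 (hmem 1 0)).1
    have h3 := hdiff 0 1 0 0 h01 (by omega) (by omega)
    have := tri (σ 0 0) u (σ 1 0)
    have := comm (σ 0 0) u
    omega
  have hS := hG.isSandwich_levelSet (le_of_mem_levelSet (hmem 0 0))
  obtain ⟨c, hc, hc0, hc1, hc2⟩ := hS.down (hmem 0 0) (hmem 1 0) (hmem 2 0)
    (hdiff _ _ _ _ h01 (by omega) (by omega)).le (hdiff _ _ _ _ h12 (by omega) (by omega)).le
    (hdiff _ _ _ _ h02 (by omega) (by omega)).le
  have hca : ∀ a, G.dist c (σ a 0) = 1 := by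
    intro a
    fin_cases a <;> assumption
  have hex : ∀ a i, ∃ y ∈ levelSet G u v k, i < n →
      G.dist y (σ a i) = 1 ∧ G.dist y (σ a (i + 1)) = 1 := by
    intro a i
    by_cases hi : i < n
    · obtain ⟨y, hy, h1, h2⟩ := hS.down_two (hmem a i) (hmem a (i + 1))
        (by rw [hsame _ _ _ (by omega) (by omega)]; omega)
      exact ⟨y, hy, fun _ => ⟨h1, h2⟩⟩
    · exact ⟨c, hc, fun h => absurd h hi⟩
  choose y hy hyσ using hex
  let τ : Fin 3 → ℕ → V := fun a i => match i with
    | 0 => c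
    | i + 1 => y a i
  have hτmem : ∀ a i, τ a i ∈ levelSet G u v k := by
    rintro a (_ | i)
    · exact hc
    · exact hy a i
  have hτup : ∀ a i, i ≤ n → G.dist (τ a i) (σ a i) = 1 := by
    rintro a (_ | i) hi
    · exact hca a
    · exact (hyσ a i (by omega)).2
  have hτup' : ∀ a i, i + 1 ≤ n → G.dist (τ a (i + 1)) (σ a i) = 1 := fun a i hi =>
    (hyσ a i (by omega)).1
  have hle : ∀ a i j, i ≤ j → j ≤ n → G.dist (τ a i) (τ a j) ≤ j - i := by
    intro a i j hij
    induction j, hij using Nat.le_induction with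
    | base => intro _; simp
    | succ j hij ih =>
      intro hj
      have h1 := ih (by omega)
      have h2 := hS.down_clique (hmem a j) (hτmem a j) (hτmem a (j + 1)) (hτup a j (by omega)).le
        (hτup' a j hj).le
      have := tri (τ a i) (τ a j) (τ a (j + 1))
      omega
  have hdiff' : ∀ a b i j, a ≠ b → i ≤ n → j ≤ n → G.dist (τ a i) (τ b j) = i + j := by
    intro a b i j hab hi hj
    have h1 := hdiff a b i j hab hi hj
    have h2 := hG.dist_le_add_one_of_above (hτmem a i) (hτmem b j) (hmem a i) (hmem b j)
      (hτup a i hi).le (hτup b j hj).le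
    have h3 := hle a 0 i (by omega) hi
    have h4 := hle b 0 j (by omega) hj
    have := tri (τ a i) c (τ b j)
    have c1 := comm (τ a i) c
    change G.dist c (τ a i) ≤ _ at h3
    change G.dist c (τ b j) ≤ _ at h4
    omega
  have hsame' : ∀ a i j, i ≤ j → j ≤ n → G.dist (τ a i) (τ a j) = j - i := by
    intro a i j hij hj
    refine le_antisymm (hle a i j hij hj) ?_
    rcases i with _ | i
    · obtain ⟨b, hb⟩ : ∃ b : Fin 3, b ≠ a := exists_ne a
      have := hdiff' b a 0 j hb (by omega) hj
      change G.dist c (τ a j) = _ at this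
      change _ ≤ G.dist c (τ a j)
      omega
    · have h1 := hsame a i j (by omega) hj
      have h2 := hG.dist_le_add_one_of_above (hτmem a (i + 1)) (hτmem a j) (hmem a i) (hmem a j)
        (hτup' a i (by omega)).le (hτup a j hj).le
      omega
  refine ⟨k, τ, fun a i _ => hτmem a i, fun a i j hi hj => ?_, hdiff'⟩
  rcases le_total i j with h | h
  · rw [hsame' a i j h hj]; omega
  · rw [comm, hsame' a j i h hi]; omega

/-- A row of the triplane mapped to the set `S`: neighbouring vertices of the row have distance at
most `1`, and the half-planes agree on the axis. The argument is the offset; only offsets of the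
parity of the row matter. -/
structure IsRow (G : SimpleGraph V) (S : Set V) (R : ℕ → Fin 3 → V) : Prop where
  mem : ∀ o a, R o a ∈ S
  step : ∀ o a, G.dist (R o a) (R (o + 2) a) ≤ 1
  triangle : ∀ a b, G.dist (R 1 a) (R 1 b) ≤ 1
  axis : ∀ a b, R 0 a = R 0 b

/-- The diagonal edges between two consecutive rows. -/
structure IsRowLink (G : SimpleGraph V) (R R' : ℕ → Fin 3 → V) : Prop where
  out : ∀ o a, G.dist (R' o a) (R (o + 1) a) ≤ 1
  inn : ∀ o a, G.dist (R' (o + 1) a) (R o a) ≤ 1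

/-- Half of an arrowhead: `T` successive rows below a given one. -/
structure IsCone (G : SimpleGraph V) (u v : V) (k T : ℕ) (R : ℕ → ℕ → Fin 3 → V) : Prop where
  row : ∀ t ≤ T, IsRow G (levelSet G u v (k - t)) (R t)
  link : ∀ t < T, IsRowLink G (R t) (R (t + 1))

lemma exists_next_row (hG : IsBridged G) {u v : V} {l : ℕ} {R : ℕ → Fin 3 → V}
    (hR : IsRow G (levelSet G u v (l + 1)) R) :
    ∃ R', IsRow G (levelSet G u v l) R' ∧ IsRowLink G R R' := by
  have hS := hG.isSandwich_levelSet (le_of_mem_levelSet (hR.mem 0 0))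
  obtain ⟨c, hc, hc0, hc1, hc2⟩ := hS.down (hR.mem 1 0) (hR.mem 1 1) (hR.mem 1 2)
    (hR.triangle _ _) (hR.triangle _ _) (hR.triangle _ _)
  have hca : ∀ a, G.dist c (R 1 a) ≤ 1 := by
    intro a
    fin_cases a
    · exact hc0.le
    · exact hc1.le
    · exact hc2.le
  choose y hy hy1 hy2 using fun o a => hS.down_two (hR.mem o a) (hR.mem (o + 2) a) (hR.step o a)
  let R' : ℕ → Fin 3 → V := fun o a => match o with
    | 0 => c
    | o + 1 => y o a
  have hmem : ∀ o a, R' o a ∈ levelSet G u v l := by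
    rintro (_ | o) a
    · exact hc
    · exact hy o a
  have hout : ∀ o a, G.dist (R' o a) (R (o + 1) a) ≤ 1 := by
    rintro (_ | o) a
    · exact hca a
    · exact (hy2 o a).le
  have hinn : ∀ o a, G.dist (R' (o + 1) a) (R o a) ≤ 1 := fun o a => (hy1 o a).le
  refine ⟨R', ⟨hmem, fun o a => ?_, fun a b => ?_, fun a b => rfl⟩, ⟨hout, hinn⟩⟩
  · exact hS.down_clique (hR.mem (o + 1) a) (hmem o a) (hmem (o + 2) a) (hout o a) (hinn (o + 1) a)
  · refine hS.down_clique (hR.mem 0 a) (hmem 1 a) (hmem 1 b) (hinn 0 a) ?_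
    rw [hR.axis a b]
    exact hinn 0 b

lemma exists_isCone (hG : IsBridged G) {u v : V} {k : ℕ} {R₀ : ℕ → Fin 3 → V}
    (hR : IsRow G (levelSet G u v k) R₀) {T : ℕ} (hT : T ≤ k) :
    ∃ R, R 0 = R₀ ∧ IsCone G u v k T R := by
  induction T with
  | zero =>
    refine ⟨fun _ => R₀, rfl, fun t ht => ?_, fun t ht => absurd ht (by omega)⟩
    obtain rfl : t = 0 := by omega
    exact hR
  | succ T ih =>
    obtain ⟨R, h0, hR'⟩ := ih (by omega)
    have h1 := hR'.row T le_rfl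
    rw [show k - T = k - (T + 1) + 1 by omega] at h1
    obtain ⟨Q, hQ, hlink⟩ := exists_next_row hG h1
    refine ⟨fun t => if t ≤ T then R t else Q, by simp [h0], fun t ht => ?_, fun t ht => ?_⟩
    · by_cases h : t ≤ T
      · simp only [h, if_true]; exact hR'.row t h
      · obtain rfl : t = T + 1 := by omega
        simp only [h, if_false]; exact hQ
    · by_cases h : t + 1 ≤ T
      · simp only [h, if_true, show t ≤ T by omega]; exact hR'.link t (by omega)
      · obtain rfl : t = T := by omega
        simp only [le_refl, if_true, h, if_false]; exact hlink

namespace IsCone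

variable {u v : V} {k T : ℕ} {R : ℕ → ℕ → Fin 3 → V}

lemma dist_out (hR : IsCone G u v k T R) (hG : IsBridged G) {t : ℕ} (ht : t ≤ T) (o : ℕ)
    (a : Fin 3) : G.dist (R t o a) (R 0 (o + t) a) ≤ t := by
  induction t generalizing o with
  | zero => simp
  | succ t ih =>
    have h1 := ih (by omega) (o + 1)
    have h2 := (hR.link t (by omega)).out o a
    have := hG.1.dist_triangle (u := R (t + 1) o a) (v := R t (o + 1) a) (w := R 0 (o + 1 + t) a)
    rw [show o + (t + 1) = o + 1 + t by omega]
    omega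

lemma dist_in (hR : IsCone G u v k T R) (hG : IsBridged G) {t s : ℕ} (ht : t + s ≤ T) (o : ℕ)
    (a : Fin 3) : G.dist (R (s + t) (o + t) a) (R s o a) ≤ t := by
  induction t with
  | zero => simp
  | succ t ih =>
    have h1 := ih (by omega)
    have h2 := (hR.link (s + t) (by omega)).inn (o + t) a
    have := hG.1.dist_triangle (u := R (s + t + 1) (o + t + 1) a) (v := R (s + t) (o + t) a)
      (w := R s o a)
    rw [← add_assoc, ← add_assoc]
    omega

lemma dist_across (hR : IsCone G u v k T R) (hG : IsBridged G) {t s : ℕ} (ht : t + s ≤ T)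
    (a b : Fin 3) : G.dist (R (s + t) t a) (R 0 s b) ≤ s + t := by
  have h1 := hR.dist_in hG ht 0 a
  have h2 := hR.dist_out hG (t := s) (by omega) 0 b
  rw [(hR.row s (by omega)).axis a b] at h1
  rw [zero_add] at h1 h2
  have := hG.1.dist_triangle (u := R (s + t) t a) (v := R s 0 b) (w := R 0 s b)
  omega

lemma dist_le_one_diag (hR : IsCone G u v k T R) {t o o' : ℕ} {a a' : Fin 3} (ht : t < T)
    (hw : a = a' ∨ o = 0 ∨ o' = 0) (ho : o = o' + 1 ∨ o' = o + 1) :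
    G.dist (R (t + 1) o a) (R t o' a') ≤ 1 := by
  rcases ho with rfl | rfl
  · have h := (hR.link t ht).inn o' a
    rcases hw with rfl | hw | rfl
    · exact h
    · omega
    · rwa [(hR.row t (by omega)).axis a a'] at h
  · have h := (hR.link t ht).out o a'
    rcases hw with rfl | rfl | hw
    · exact h
    · rwa [(hR.row (t + 1) (by omega)).axis a' a] at h
    · omega

lemma dist_le_one_horizontal (hR : IsCone G u v k T R) {t o o' : ℕ} {a a' : Fin 3} (ht : t ≤ T)
    (hw : a = a' ∨ o = 0 ∨ o' = 0) (ho : o = o' + 2 ∨ o' = o + 2) :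
    G.dist (R t o a) (R t o' a') ≤ 1 := by
  rcases ho with rfl | rfl
  · have h := (hR.row t ht).step o' a
    rw [SimpleGraph.dist_comm] at h
    rcases hw with rfl | hw | rfl
    · exact h
    · omega
    · rwa [(hR.row t ht).axis a a'] at h
  · have h := (hR.row t ht).step o a'
    rcases hw with rfl | rfl | hw
    · exact h
    · rwa [(hR.row t ht).axis a' a] at h
    · omega

/-- Vertices of the triplane which are adjacent and lie in rows on the same side of the row `m`
are mapped to adjacent or equal vertices. -/
lemma dist_le_one_of_adj (hR : IsCone G u v k T R) {x y : TriplaneVertex} {s t : ℕ}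
    (h : triplane.Adj x y) (hs : s ≤ T) (ht : t ≤ T)
    (hst : x.row - y.row = (s : ℤ) - t ∨ x.row - y.row = (t : ℤ) - s) :
    G.dist (R s x.off x.wing) (R t y.off y.wing) ≤ 1 := by
  rcases triplane_adj_cases h with ⟨hw, ⟨h1, h2⟩ | ⟨h1, h2⟩⟩ | ⟨-, h1, h2, h3⟩
  · rcases (by omega : s = t + 1 ∨ t = s + 1) with rfl | rfl
    · exact hR.dist_le_one_diag (by omega) hw h2
    · rw [SimpleGraph.dist_comm]
      refine hR.dist_le_one_diag (by omega) ?_ h2.symm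
      rcases hw with h | h | h
      · exact Or.inl h.symm
      · exact Or.inr (Or.inr h)
      · exact Or.inr (Or.inl h)
  · obtain rfl : s = t := by omega
    exact hR.dist_le_one_horizontal hs hw h2
  · obtain rfl : s = t := by omega
    rw [h2, h3]
    exact (hR.row s hs).triangle _ _

/-- From a vertex of a cone one can move diagonally to the row `0`, either outwards or inwards. In
the second case one may pass the axis, and then continue in any half-plane. -/
lemma exists_lift (hR : IsCone G u v k T R) (hG : IsBridged G) {t o : ℕ} (a : Fin 3) (ht : t ≤ T) :
    G.dist (R t o a) (R 0 (o + t) a) ≤ t ∧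
      ((∃ o', o' + t = o ∧ G.dist (R t o a) (R 0 o' a) ≤ t) ∨
        (∃ o', o' + o = t ∧ ∀ b, G.dist (R t o a) (R 0 o' b) ≤ t)) := by
  refine ⟨hR.dist_out hG ht o a, ?_⟩
  rcases le_total t o with h | h
  · obtain ⟨d, rfl⟩ := Nat.exists_eq_add_of_le h
    refine Or.inl ⟨d, by omega, ?_⟩
    have := hR.dist_in hG (t := t) (s := 0) (by omega) d a
    rwa [zero_add, add_comm d t] at this
  · obtain ⟨d, rfl⟩ := Nat.exists_eq_add_of_le h
    refine Or.inr ⟨d, by omega, fun b => ?_⟩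
    have := hR.dist_across hG (t := o) (s := d) (by omega) a b
    rwa [add_comm d o] at this

end IsCone

end Arrowheads

section ArrowheadEmbedding

variable {V : Type*} {G : SimpleGraph V}

/-- The middle row of an arrowhead, read off from a tripod. -/
def tripodRow (τ : Fin 3 → ℕ → V) (n : ℕ) (o : ℕ) (a : Fin 3) : V :=
  τ a (min (o / 2) n)

lemma IsTripodIn.isRow (hG : IsBridged G) {S : Set V} {n : ℕ} {τ : Fin 3 → ℕ → V}
    (hτ : IsTripodIn G S n τ) : IsRow G S (tripodRow τ n) := by
  have haxis : ∀ a b, τ a 0 = τ b 0 := by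
    intro a b
    by_cases hab : a = b
    · rw [hab]
    · exact hG.1.dist_eq_zero_iff.1 (hτ.diff a b 0 0 hab (by omega) (by omega))
  refine ⟨fun o a => hτ.mem _ _ (by omega), fun o a => ?_, fun a b => ?_, fun a b => ?_⟩
  · unfold tripodRow
    rw [hτ.same _ _ _ (by omega) (by omega)]
    omega
  · simp [tripodRow, haxis a b]
  · simp [tripodRow, haxis a b]

lemma IsTripodIn.two_mul_dist_tripodRow {S : Set V} {n : ℕ} {τ : Fin 3 → ℕ → V}
    (hτ : IsTripodIn G S n τ) {i j : ℕ} (hi : i ≤ n) (hj : j ≤ n) (a b : Fin 3) :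
    G.dist (tripodRow τ n (2 * i) a) (tripodRow τ n (2 * j) b) =
      if a = b then (i - j) + (j - i) else i + j := by
  unfold tripodRow
  split_ifs with hab
  · subst hab
    rw [hτ.same _ _ _ (by omega) (by omega)]
    omega
  · rw [hτ.diff _ _ _ _ hab (by omega) (by omega)]
    omega

/-- Two vertices of the cones over a tripod can be moved diagonally to the middle row so that they
end up as far apart as possible. -/
lemma IsTripodIn.exists_lifts (hG : IsBridged G) {S : Set V} {n : ℕ} {τ : Fin 3 → ℕ → V}
    (hτ : IsTripodIn G S n τ) {u v u' v' : V} {k k' T T' : ℕ} {R R' : ℕ → ℕ → Fin 3 → V}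
    (hR : IsCone G u v k T R) (hR' : IsCone G u' v' k' T' R') (h0 : R 0 = tripodRow τ n)
    (h0' : R' 0 = tripodRow τ n) {t o t' o' : ℕ} (a b : Fin 3) (ht : t ≤ T) (ht' : t' ≤ T')
    (ho : ∃ i ≤ n, o + t = 2 * i) (ho' : ∃ i ≤ n, o' + t' = 2 * i) :
    ∃ p ∈ S, ∃ q ∈ S, G.dist (R t o a) p ≤ t ∧ G.dist (R' t' o' b) q ≤ t' ∧
      t + t' + (if a = b then (o - o') + (o' - o) else o + o') ≤ 2 * G.dist p q := by
  have hrow := hτ.isRow hG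
  obtain ⟨i, hi, hoi⟩ := ho
  obtain ⟨j, hj, hoj⟩ := ho'
  obtain ⟨h1, h2⟩ := hR.exists_lift hG (o := o) a ht
  obtain ⟨h1', h2'⟩ := hR'.exists_lift hG (o := o') b ht'
  rw [h0] at h1 h2
  rw [h0'] at h1' h2'
  rw [hoi] at h1
  rw [hoj] at h1'
  by_cases hab : a = b
  · subst hab
    obtain ⟨c, hc⟩ : ∃ c : Fin 3, c ≠ a := exists_ne a
    -- the vertex with the larger offset moves outwards, the other one inwards
    rcases le_total o o' with hoo | hoo
    · rcases h2 with ⟨r, hr, h3⟩ | ⟨r, hr, h3⟩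
      · refine ⟨_, hrow.mem _ _, _, hrow.mem _ _, h3, h1', ?_⟩
        rw [show r = 2 * (i - t) by omega, hτ.two_mul_dist_tripodRow (by omega) hj, if_pos rfl,
          if_pos rfl]
        omega
      · refine ⟨_, hrow.mem _ _, _, hrow.mem _ _, h3 c, h1', ?_⟩
        rw [show r = 2 * (i - o) by omega, hτ.two_mul_dist_tripodRow (by omega) hj, if_pos rfl,
          if_neg hc]
        omega
    · rcases h2' with ⟨r, hr, h3⟩ | ⟨r, hr, h3⟩
      · refine ⟨_, hrow.mem _ _, _, hrow.mem _ _, h1, h3, ?_⟩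
        rw [show r = 2 * (j - t') by omega, hτ.two_mul_dist_tripodRow hi (by omega), if_pos rfl,
          if_pos rfl]
        omega
      · refine ⟨_, hrow.mem _ _, _, hrow.mem _ _, h1, h3 c, ?_⟩
        rw [show r = 2 * (j - o') by omega, hτ.two_mul_dist_tripodRow hi (by omega), if_pos rfl,
          if_neg hc.symm]
        omega
  · refine ⟨_, hrow.mem _ _, _, hrow.mem _ _, h1, h1', ?_⟩
    rw [hτ.two_mul_dist_tripodRow hi hj, if_neg hab, if_neg hab]
    omega

lemma dist_bounds_same_side (hG : IsBridged G) {u v x y p q : V} {k t t' : ℕ} (ht : t ≤ k)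
    (ht' : t' ≤ k) (hx : x ∈ levelSet G u v (k - t)) (hy : y ∈ levelSet G u v (k - t'))
    (hp : p ∈ levelSet G u v k) (hq : q ∈ levelSet G u v k) (hxp : G.dist x p ≤ t)
    (hyq : G.dist y q ≤ t') :
    (t - t') + (t' - t) ≤ G.dist x y ∧ G.dist p q ≤ G.dist x y + min t t' := by
  have comm := fun a b : V => SimpleGraph.dist_comm (G := G) (u := a) (v := b)
  constructor
  · have h1 := (mem_levelSet_iff.1 hx).1
    have h2 := (mem_levelSet_iff.1 hy).1
    have := hG.1.dist_triangle (u := u) (v := x) (w := y)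
    have := hG.1.dist_triangle (u := u) (v := y) (w := x)
    have := comm x y
    omega
  · rcases le_total t t' with h | h
    · have := hG.dist_le_add_of_above_above (u := u) (v := v) (s := k - t') (t := t' - t) (j := t)
        (x := x) (y := y) (x' := p) (y' := q) (by rwa [show k - t' + (t' - t) = k - t by omega]) hy
        (by rwa [show k - t' + (t' - t) + t = k by omega])
        (by rwa [show k - t' + (t' - t) + t = k by omega]) hxp (by omega)
      omega
    · have := hG.dist_le_add_of_above_above (u := u) (v := v) (s := k - t) (t := t - t') (j := t')
        (x := y) (y := x) (x' := q) (y' := p) (by rwa [show k - t + (t - t') = k - t' by omega]) hx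
        (by rwa [show k - t + (t - t') + t' = k by omega])
        (by rwa [show k - t + (t - t') + t' = k by omega]) hyq (by omega)
      have := comm x y
      have := comm p q
      omega

lemma dist_bounds_opposite_sides (hG : IsBridged G) {u v x y p q : V} {k l t t' : ℕ}
    (hkl : k + l = G.dist u v) (ht : t ≤ k) (ht' : t' ≤ l) (hx : x ∈ levelSet G u v (k - t))
    (hy : y ∈ levelSet G v u (l - t')) (hp : p ∈ levelSet G u v k) (hq : q ∈ levelSet G u v k)
    (hxp : G.dist x p ≤ t) (hyq : G.dist y q ≤ t') :
    t + t' ≤ G.dist x y ∧ G.dist p q ≤ G.dist x y := by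
  have comm := fun a b : V => SimpleGraph.dist_comm (G := G) (u := a) (v := b)
  have hy' : y ∈ levelSet G u v (k + t') := mem_levelSet_swap (by rw [comm v u]; omega) hy
  constructor
  · have h1 := (mem_levelSet_iff.1 hx).1
    have h2 := (mem_levelSet_iff.1 hy').1
    have := hG.1.dist_triangle (u := u) (v := x) (w := y)
    omega
  · have := hG.dist_le_of_below_above (u := u) (v := v) (s := k - t) (t := t) (j := t')
      (x := y) (y := x) (x' := q) (y' := p) (by rwa [show k - t + t = k by omega]) hx
      (by rwa [show k - t + t = k by omega]) (by rwa [show k - t + t = k by omega]) hyq hxp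
    have := comm x y
    have := comm p q
    omega

/-- The map from the triplane determined by two cones, below and above the row `m`. -/
def coneMap (m : ℕ) (D U : ℕ → ℕ → Fin 3 → V) (x : TriplaneVertex) : V :=
  if x.row ≤ m then D (m - x.row).toNat x.off x.wing else U (x.row - m).toNat x.off x.wing

lemma coneMap_lower {m : ℕ} {D U : ℕ → ℕ → Fin 3 → V} {x : TriplaneVertex} {t : ℕ}
    (h : x.row = m - t) : coneMap m D U x = D t x.off x.wing := by
  unfold coneMap
  rw [if_pos (by omega), show ((m : ℤ) - x.row).toNat = t by omega]

lemma coneMap_upper {m : ℕ} {D U : ℕ → ℕ → Fin 3 → V} (h0 : D 0 = U 0) {x : TriplaneVertex} {t : ℕ}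
    (h : x.row = m + t) : coneMap m D U x = U t x.off x.wing := by
  rcases t with _ | t
  · rw [coneMap_lower (t := 0) (by omega), h0]
  · unfold coneMap
    rw [if_neg (by omega), show (x.row - (m : ℤ)).toNat = t + 1 by omega]

/-- The two cones over a tripod form an arrowhead. -/
lemma IsTripodIn.containsIsometric_arrowhead (hG : IsBridged G) {u v : V} {k n p : ℕ}
    {τ : Fin 3 → ℕ → V} (hτ : IsTripodIn G (levelSet G u v k) n τ) (hpn : 2 * p ≤ n) :
    ContainsIsometric G (arrowhead (2 * p)) := by
  have tri := fun a b c : V => hG.1.dist_triangle (u := a) (v := b) (w := c)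
  have comm := fun a b : V => SimpleGraph.dist_comm (G := G) (u := a) (v := b)
  obtain ⟨l, hkl⟩ : ∃ l, k + l = G.dist u v :=
    ⟨_, Nat.add_sub_of_le (le_of_mem_levelSet (hτ.mem 0 0 (by omega)))⟩
  have hnk : n ≤ k ∧ n ≤ l := by
    have h1 := mem_levelSet_iff.1 (hτ.mem 0 n le_rfl)
    have h2 := mem_levelSet_iff.1 (hτ.mem 1 n le_rfl)
    have h3 := hτ.diff 0 1 n n (by decide) le_rfl le_rfl
    have := tri (τ 0 n) u (τ 1 n)
    have := tri (τ 0 n) v (τ 1 n)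
    have := comm (τ 0 n) u
    have := comm (τ 1 n) v
    omega
  have hrow := hτ.isRow hG
  have hrow' : IsRow G (levelSet G v u l) (tripodRow τ n) :=
    ⟨fun o a => mem_levelSet_swap hkl (hrow.mem o a), hrow.step, hrow.triangle, hrow.axis⟩
  obtain ⟨D, hD0, hD⟩ := exists_isCone hG hrow (T := 2 * p) (by omega)
  obtain ⟨U, hU0, hU⟩ := exists_isCone hG hrow' (T := 2 * p) (by omega)
  have h0 : D 0 = U 0 := by rw [hD0, hU0]
  have hpos : ∀ x ∈ diamond (2 * p), ∃ t : ℕ, t ≤ 2 * p ∧ (∃ i ≤ n, x.off + t = 2 * i) ∧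
      (x.row = (2 * p : ℕ) - t ∨ x.row = (2 * p : ℕ) + t) := by
    intro x hx
    obtain ⟨c, hc⟩ := x.exists_two_mul
    rw [mem_diamond_iff] at hx
    push_cast at hx
    rcases le_total x.row (2 * p : ℕ) with h | h
    · refine ⟨((2 * p : ℕ) - x.row).toNat, by omega, ⟨(x.off + ((2 * p : ℕ) - x.row).toNat) / 2,
        by omega, by omega⟩, by omega⟩
    · refine ⟨(x.row - (2 * p : ℕ)).toNat, by omega, ⟨(x.off + (x.row - (2 * p : ℕ)).toNat) / 2,
        by omega, by omega⟩, by omega⟩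
  have hlow : ∀ x ∈ diamond (2 * p), ∀ y ∈ diamond (2 * p),
      triplaneDist x y ≤ G.dist (coneMap (2 * p) D U x) (coneMap (2 * p) D U y) := by
    intro x hx y hy
    obtain ⟨t, ht, hxo, hxr⟩ := hpos x hx
    obtain ⟨t', ht', hyo, hyr⟩ := hpos y hy
    have hΔ : (if x.wing = y.wing then ((x.off : ℤ) - y.off).natAbs else x.off + y.off) =
        if x.wing = y.wing then (x.off - y.off) + (y.off - x.off) else x.off + y.off := by
      split_ifs <;> omega
    unfold triplaneDist
    rw [hΔ]
    generalize hE : (if x.wing = y.wing then (x.off - y.off) + (y.off - x.off)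
      else x.off + y.off) = E
    rcases hxr with hxr | hxr <;> rcases hyr with hyr | hyr
    · rw [coneMap_lower hxr, coneMap_lower hyr]
      obtain ⟨q, hq, q', hq', h1, h2, h3⟩ := hτ.exists_lifts hG hD hD hD0 hD0 x.wing y.wing ht ht'
        hxo hyo
      have := dist_bounds_same_side hG (by omega) (by omega) ((hD.row t ht).mem x.off x.wing)
        ((hD.row t' ht').mem y.off y.wing) hq hq' h1 h2
      omega
    · rw [coneMap_lower hxr, coneMap_upper h0 hyr]
      obtain ⟨q, hq, q', hq', h1, h2, h3⟩ := hτ.exists_lifts hG hD hU hD0 hU0 x.wing y.wing ht ht'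
        hxo hyo
      have := dist_bounds_opposite_sides hG hkl (by omega) (by omega)
        ((hD.row t ht).mem x.off x.wing) ((hU.row t' ht').mem y.off y.wing) hq hq' h1 h2
      omega
    · rw [coneMap_upper h0 hxr, coneMap_lower hyr, comm]
      obtain ⟨q, hq, q', hq', h1, h2, h3⟩ := hτ.exists_lifts hG hU hD hU0 hD0 x.wing y.wing ht ht'
        hxo hyo
      have := dist_bounds_opposite_sides hG hkl (by omega) (by omega)
        ((hD.row t' ht').mem y.off y.wing) ((hU.row t ht).mem x.off x.wing) hq' hq h2 h1
      have := comm q q'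
      omega
    · rw [coneMap_upper h0 hxr, coneMap_upper h0 hyr]
      obtain ⟨q, hq, q', hq', h1, h2, h3⟩ := hτ.exists_lifts hG hU hU hU0 hU0 x.wing y.wing ht ht'
        hxo hyo
      have := dist_bounds_same_side hG (by omega) (by omega) ((hU.row t ht).mem x.off x.wing)
        ((hU.row t' ht').mem y.off y.wing) (mem_levelSet_swap hkl hq) (mem_levelSet_swap hkl hq')
        h1 h2
      omega
  have hadj : ∀ x ∈ diamond (2 * p), ∀ y ∈ diamond (2 * p), triplane.Adj x y →
      G.dist (coneMap (2 * p) D U x) (coneMap (2 * p) D U y) ≤ 1 := by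
    intro x hx y hy h
    have hr : x.row - y.row ≤ 1 ∧ y.row - x.row ≤ 1 := by
      rcases triplane_adj_cases h with ⟨-, h | h⟩ | h <;> omega
    rw [mem_diamond_iff] at hx hy
    push_cast at hx hy
    by_cases hle : x.row ≤ (2 * p : ℕ) ∧ y.row ≤ (2 * p : ℕ)
    · obtain ⟨s, hs⟩ := Int.eq_ofNat_of_zero_le (by omega : 0 ≤ ((2 * p : ℕ) : ℤ) - x.row)
      obtain ⟨t, ht⟩ := Int.eq_ofNat_of_zero_le (by omega : 0 ≤ ((2 * p : ℕ) : ℤ) - y.row)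
      rw [coneMap_lower (t := s) (by omega), coneMap_lower (t := t) (by omega)]
      exact hD.dist_le_one_of_adj h (by omega) (by omega) (by omega)
    · obtain ⟨s, hs⟩ := Int.eq_ofNat_of_zero_le (by omega : 0 ≤ x.row - ((2 * p : ℕ) : ℤ))
      obtain ⟨t, ht⟩ := Int.eq_ofNat_of_zero_le (by omega : 0 ≤ y.row - ((2 * p : ℕ) : ℤ))
      rw [coneMap_upper h0 (t := s) (by omega), coneMap_upper h0 (t := t) (by omega)]
      exact hU.dist_le_one_of_adj h (by omega) (by omega) (by omega)
  refine ⟨fun x => coneMap (2 * p) D U x.1, fun x y => le_antisymm ?_ ?_⟩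
  · exact dist_le_dist_of_adj hG.1 (fun a b hab => hadj a.1 (mem_interval_axis_iff.1 a.2) b.1
      (mem_interval_axis_iff.1 b.2) hab) (arrowhead_dist x y).1
  · rw [(arrowhead_dist x y).2]
    exact hlow _ (mem_interval_axis_iff.1 x.2) _ (mem_interval_axis_iff.1 y.2)

lemma IsHarmless.exists_isBranchless (hG : IsBridged G) {M : ℕ} (hM : IsHarmless G M) :
    ∃ N, ∀ (u v : V) (k : ℕ), IsBranchless (level G u v k) N := by
  have key : ∀ {u v : V} {k n : ℕ} {τ : Fin 3 → ℕ → V}, 2 * (M + 1) < n →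
      ¬ IsTripodIn G (levelSet G u v k) n τ := fun hn hτ =>
    hM (2 * (M + 1)) (by omega) (hτ.containsIsometric_arrowhead hG hn.le)
  refine ⟨2 * (M + 1), fun u v k n hn => ⟨fun h => ?_, fun h => ?_⟩⟩
  · obtain ⟨τ, hτ⟩ := exists_isTripodIn_of_tripod hG h
    exact key hn hτ
  · obtain ⟨l, τ, hτ⟩ := exists_isTripodIn_of_asteroid hG (by omega) h
    exact key hn hτ

end ArrowheadEmbedding

end FitSystolic

theorem mainTheorem7 {V : Type*} (X : AbstractSimplicialComplex V)
    (hX : FitSystolic.IsSystolic X) :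
    List.TFAE
      [FitSystolic.IsFit X,
        ∃ N : ℕ, FitSystolic.LevelsBranchless X N,
        ∃ M : ℕ, FitSystolic.IsHarmless (FitSystolic.skeleton X) M] ∧
    ∀ N : ℕ, FitSystolic.LevelsBranchless X N →
      FitSystolic.LevelsQuasiSegments X 1 (2 * (N : ℝ) + 2) := by
  have hG := hX.2
  have hquasi : ∀ N : ℕ, FitSystolic.LevelsBranchless X N →
      FitSystolic.LevelsQuasiSegments X 1 (2 * (N : ℝ) + 2) := fun N hN u v k hk =>
    FitSystolic.isQuasiSegment_level hG hk (hN u v k hk)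
  refine ⟨?_, hquasi⟩
  tfae_have 1 → 3 := fun ⟨B, C, hB, hC, h⟩ =>
    FitSystolic.exists_isHarmless_of_quasiSegments hG hB hC h
  tfae_have 3 → 2 := fun ⟨M, hM⟩ =>
    (FitSystolic.IsHarmless.exists_isBranchless hG hM).imp fun N hN u v k _ => hN u v k
  tfae_have 2 → 1 := fun ⟨N, hN⟩ => ⟨1, 2 * (N : ℝ) + 2, one_pos, by positivity, hquasi N hN⟩
  tfae_finish
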